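/- Let $\varphi:(0,\infty)\to(0,\infty)$ satisfy: (i) $\varphi\in C^1((0,\infty))$; (ii) $(s\varphi(s))'>0$ for all $s>0$; (iii) the range of $s\mapsto s\varphi(s)$ on $(0,\infty)$ is $(0,\infty)$; (iv) there are $C_1,C_2>0$, $r>-1$ and $s_0>0$ with $C_1s^r\le (s\varphi(s))'\le C_2s^r$ for $s\in(0,s_0)$; if $r=0$, moreover $\lim_{s\to0^+}\varphi(s)$ exists and is finite and positive, and $\lim_{s\to0^+}s\varphi'(s)=0$; (v) there is $s_1>s_0$ such that either $\varphi'(s)\ge0$ for all $s\ge s_1$ or $\varphi'(s)\le0$ for all $s\ge s_1$; (vi) $s\mapsto|s\varphi'(s)/\varphi(s)|$ is non-decreasing on $(0,\infty)$. Let $\Lambda$ be the function on $(0,\infty)$ defined by $$\Lambda\big(s\sqrt{\varphi(s)}\big)=-\frac{s\varphi'(s)}{s\varphi'(s)+2\varphi(s)}\qquad(s>0),$$ and let $\Lambda_\infty=\lim_{t\to\infty}\Lambda(t)$; this limit exists and $\Lambda_\infty^2=\sup_{t>0}\Lambda^2(t)$. Assume that $\sup_{t>0}\Lambda^2(t)<1$.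 Let $\Omega\subset\mathbb R^n$ be a domain and, for $h=1,\dots,n$, let $\mathscr A^h$ be an $m\times m$ matrix whose entries are complex-valued functions in $L^1_{\mathrm{loc}}(\Omega)$. Write $\langle\cdot,\cdot\rangle$ for the standard Hermitian product on $\mathbb C^m$. The operator $Au=\sum_{h=1}^n\partial_h(\mathscr A^h\partial_hu)$ is called strictly $L^\Phi$-dissipative if there is $\kappa>0$ such that $$\operatorname{Re}\int_\Omega\sum_{h=1}^n\langle\mathscr A^h\partial_hu,\partial_h(\varphi(|u|)u)\rangle\,dx\ \ge\ \kappa\int_\Omega\big|\nabla\big(\sqrt{\varphi(|u|)}\,u\big)\big|^2dx$$ for every $u\in[C^1_c(\Omega)]^m$ with $\varphi(|u|)u\in[C^1_c(\Omega)]^m$ (where $\varphi(|u|)u$ and $\sqrt{\varphi(|u|)}\,u$ are understood to be $0$ where $u=0$). Theorem. $A$ is strictly $L^\Phi$-dissipative if and only if there is $\kappa'>0$ such that, for almost every $x\in\Omega$, $$\operatorname{Re}\langle\mathscr A^h(x)\lambda,\lambda\rangle-\Lambda_\infty^2\operatorname{Re}\langle\mathscr A^h(x)\omega,\omega\rangle(\operatorname{Re}\langle\lambda,\omega\rangle)^2+\Lambda_\infty\operatorname{Re}\big(\langle\mathscr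 A^h(x)\omega,\lambda\rangle-\langle\mathscr A^h(x)\lambda,\omega\rangle\big)\operatorname{Re}\langle\lambda,\omega\rangle\ \ge\ \kappa'|\lambda|^2$$ for all $\lambda,\omega\in\mathbb C^m$ with $|\omega|=1$ and each $h=1,\dots,n$ (no summation over $h$). -/

import Mathlib

open Set Filter Topology MeasureTheory

/-- `ℝⁿ` with its Euclidean norm. -/
abbrev RSpace (n : ℕ) : Type := EuclideanSpace ℝ (Fin n)

/-- `ℂᵐ` with its Hermitian norm. -/
abbrev CSpace (m : ℕ) : Type := EuclideanSpace ℂ (Fin m)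

/-- The standing conditions on `φ : (0,∞) → (0,∞)`. Only the values of `φ` on `(0,∞)` matter. -/
structure AdmissibleWeight (φ : ℝ → ℝ) : Prop where
  pos : ∀ s, 0 < s → 0 < φ s
  contDiffOn : ContDiffOn ℝ 1 φ (Ioi 0)
  deriv_pos : ∀ s, 0 < s → 0 < deriv (fun σ => σ * φ σ) s
  range_eq : (fun s => s * φ s) '' Ioi 0 = Ioi 0
  /-- The power-like behaviour at `0`, with its supplement for `r = 0`, and the constant sign
  of `φ'` near infinity. -/
  growth : ∃ C₁ C₂ r s₀ : ℝ, 0 < C₁ ∧ 0 < C₂ ∧ -1 < r ∧ 0 < s₀ ∧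
    (∀ s ∈ Ioo 0 s₀, C₁ * s ^ r ≤ deriv (fun σ => σ * φ σ) s ∧
      deriv (fun σ => σ * φ σ) s ≤ C₂ * s ^ r) ∧
    (r = 0 → (∃ φ₀ : ℝ, 0 < φ₀ ∧ Tendsto φ (𝓝[>] 0) (𝓝 φ₀)) ∧
      Tendsto (fun s => s * deriv φ s) (𝓝[>] 0) (𝓝 0)) ∧
    ∃ s₁ : ℝ, s₀ < s₁ ∧ ((∀ s, s₁ ≤ s → 0 ≤ deriv φ s) ∨ (∀ s, s₁ ≤ s → deriv φ s ≤ 0))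
  monotone_abs : MonotoneOn (fun s => |s * deriv φ s / φ s|) (Ioi 0)

/-- The inverse on `(0,∞)` of the bijection `s ↦ s √(φ s)` of `(0,∞)`
(see `AdmissibleWeight.bijOn_sqrt`). -/
noncomputable def sqrtInv (φ : ℝ → ℝ) (t : ℝ) : ℝ :=
  Function.invFunOn (fun s => s * √(φ s)) (Ioi 0) t

/-- The function `Λ`, determined on `(0,∞)` by
`Λ (s √(φ s)) = - s φ'(s) / (s φ'(s) + 2 φ(s))` (see `AdmissibleWeight.lam_sqrt`). -/
noncomputable def Lam (φ : ℝ → ℝ) (t : ℝ) : ℝ :=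
  -(sqrtInv φ t * deriv φ (sqrtInv φ t)) /
    (sqrtInv φ t * deriv φ (sqrtInv φ t) + 2 * φ (sqrtInv φ t))

/-- `Λ_∞ = lim_{t → ∞} Λ(t)`. The limit exists and `Λ_∞² = sup_{t > 0} Λ(t)²`
(see `AdmissibleWeight.tendsto_lam` and `AdmissibleWeight.isLUB_lam_sq`). -/
noncomputable def LamInf (φ : ℝ → ℝ) : ℝ := limUnder atTop (Lam φ)

/-- The partial derivative `∂_h u`. -/
noncomputable def partialDeriv {n m : ℕ} (h : Fin n) (u : RSpace n → CSpace m)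
    (x : RSpace n) : CSpace m :=
  fderiv ℝ u x (EuclideanSpace.single h 1)

/-- `u ∈ [C¹_c(Ω)]ᵐ`, the functions being extended by zero to `ℝⁿ`. -/
def IsC1c {n m : ℕ} (Ω : Set (RSpace n)) (u : RSpace n → CSpace m) : Prop :=
  ContDiff ℝ 1 u ∧ HasCompactSupport u ∧ tsupport u ⊆ Ω

/-- The Hermitian product `⟨x, y⟩ = ∑ⱼ xⱼ conj(yⱼ)` on `ℂᵐ`. -/
noncomputable def herm {m : ℕ} (x y : CSpace m) : ℂ := inner ℂ y x

/-- The product of an `m × m` matrix with a vector of `ℂᵐ`. -/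
noncomputable def matVec {m : ℕ} (B : Matrix (Fin m) (Fin m) ℂ) (v : CSpace m) : CSpace m :=
  WithLp.toLp 2 (B.mulVec v.ofLp)

/-- `φ(|u|) u`, which is `0` where `u` vanishes. -/
noncomputable def weighted {n m : ℕ} (φ : ℝ → ℝ) (u : RSpace n → CSpace m) :
    RSpace n → CSpace m :=
  fun x => φ ‖u x‖ • u x

/-- `√φ(|u|) u`, which is `0` where `u` vanishes. -/
noncomputable def sqrtWeighted {n m : ℕ} (φ : ℝ → ℝ) (u : RSpace n → CSpace m) :
    RSpace n → CSpace m :=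
  fun x => √(φ ‖u x‖) • u x

/-- Strict `L^Φ`-dissipativity in `Ω` of the operator `u ↦ ∑ₕ ∂ₕ (𝒜ʰ(x) ∂ₕ u)`. -/
def StrictDissipative {n m : ℕ} (φ : ℝ → ℝ) (Ω : Set (RSpace n))
    (𝒜 : Fin n → RSpace n → Matrix (Fin m) (Fin m) ℂ) : Prop :=
  ∃ κ : ℝ, 0 < κ ∧ ∀ u : RSpace n → CSpace m, IsC1c Ω u → IsC1c Ω (weighted φ u) →
    κ * (∫ x in Ω, ∑ h, ‖partialDeriv h (sqrtWeighted φ u) x‖ ^ 2) ≤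
      (∫ x in Ω, ∑ h, herm (matVec (𝒜 h x) (partialDeriv h u x))
        (partialDeriv h (weighted φ u) x)).re

/-- The algebraic form
`Re⟨Bλ,λ⟩ - L² Re⟨Bω,ω⟩ (Re⟨λ,ω⟩)² + L Re(⟨Bω,λ⟩ - ⟨Bλ,ω⟩) Re⟨λ,ω⟩`. -/
noncomputable def algForm {m : ℕ} (L : ℝ) (B : Matrix (Fin m) (Fin m) ℂ)
    (lam ω : CSpace m) : ℝ :=
  (herm (matVec B lam) lam).re
    - L ^ 2 * (herm (matVec B ω) ω).re * (herm lam ω).re ^ 2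
    + L * (herm (matVec B ω) lam - herm (matVec B lam) ω).re * (herm lam ω).re

namespace AdmissibleWeight

variable {φ : ℝ → ℝ}

theorem hasDerivAt (hφ : AdmissibleWeight φ) {s : ℝ} (hs : 0 < s) :
    HasDerivAt φ (deriv φ s) s :=
  ((hφ.contDiffOn.differentiableOn one_ne_zero).differentiableAt (Ioi_mem_nhds hs)).hasDerivAt

theorem deriv_mul_self (hφ : AdmissibleWeight φ) {s : ℝ} (hs : 0 < s) :
    deriv (fun σ => σ * φ σ) s = φ s + s * deriv φ s := by
  have := ((hasDerivAt_id' s).fun_mul (hφ.hasDerivAt hs)).deriv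
  simpa using this

theorem neg_one_lt (hφ : AdmissibleWeight φ) {s : ℝ} (hs : 0 < s) :
    -1 < s * deriv φ s / φ s := by
  have h := hφ.deriv_pos s hs
  rw [hφ.deriv_mul_self hs] at h
  rw [lt_div_iff₀ (hφ.pos s hs)]
  linarith

theorem continuousOn (hφ : AdmissibleWeight φ) : ContinuousOn φ (Ioi 0) :=
  hφ.contDiffOn.continuousOn

theorem continuousOn_ratio (hφ : AdmissibleWeight φ) :
    ContinuousOn (fun s => s * deriv φ s / φ s) (Ioi 0) :=
  (continuousOn_id.mul (hφ.contDiffOn.continuousOn_deriv_of_isOpen isOpen_Ioi le_rfl)).div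
    hφ.continuousOn fun s hs => (hφ.pos s hs).ne'

theorem strictMonoOn_mul_self (hφ : AdmissibleWeight φ) :
    StrictMonoOn (fun s => s * φ s) (Ioi 0) := by
  refine strictMonoOn_of_deriv_pos (convex_Ioi 0) (continuousOn_id.mul hφ.continuousOn) ?_
  intro s hs
  rw [interior_Ioi] at hs
  exact hφ.deriv_pos s hs

theorem sqrt_eq (_hφ : AdmissibleWeight φ) {s : ℝ} (hs : 0 < s) :
    s * √(φ s) = √(s * (s * φ s)) := by
  rw [← mul_assoc, Real.sqrt_mul (by positivity), Real.sqrt_mul_self hs.le]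

theorem strictMonoOn_sqrt (hφ : AdmissibleWeight φ) :
    StrictMonoOn (fun s => s * √(φ s)) (Ioi 0) := by
  intro a ha b hb hab
  have ha' : 0 < a := ha
  have hb' : 0 < b := hb
  have h1 : a * φ a < b * φ b := hφ.strictMonoOn_mul_self ha hb hab
  have h2 := mul_pos ha' (hφ.pos a ha')
  simp only
  rw [hφ.sqrt_eq ha', hφ.sqrt_eq hb']
  exact Real.sqrt_lt_sqrt (by positivity) (mul_lt_mul'' hab h1 ha'.le h2.le)

/-- `s ↦ s √(φ s)` is a bijection of `(0,∞)`. -/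
theorem bijOn_sqrt (hφ : AdmissibleWeight φ) :
    BijOn (fun s => s * √(φ s)) (Ioi 0) (Ioi 0) := by
  refine ⟨fun s hs => mul_pos hs (Real.sqrt_pos.2 (hφ.pos s hs)),
    hφ.strictMonoOn_sqrt.injOn, ?_⟩
  intro t ht
  have ht' : 0 < t := ht
  have hcont : ContinuousOn (fun s => s * √(φ s)) (Ioi 0) :=
    continuousOn_id.mul hφ.continuousOn.sqrt
  obtain ⟨c, hc, hct⟩ : t ^ 2 ∈ (fun s => s * φ s) '' Ioi 0 := by
    rw [hφ.range_eq]; exact pow_pos ht' 2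
  have hc' : 0 < c := hc
  have hct' : c * φ c = t ^ 2 := hct
  have ha : 0 < min c 1 := lt_min hc' one_pos
  have hb : 0 < max c 1 := lt_max_of_lt_left hc'
  have hsub : Icc (min c 1) (max c 1) ⊆ Ioi 0 := fun x hx => lt_of_lt_of_le ha hx.1
  have h1 : min c 1 * √(φ (min c 1)) ≤ t := by
    rw [hφ.sqrt_eq ha]
    refine Real.sqrt_le_iff.2 ⟨ht'.le, ?_⟩
    have := hφ.strictMonoOn_mul_self.monotoneOn (show min c 1 ∈ Ioi 0 from ha) hc
      (min_le_left c 1)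
    have h0 := mul_pos ha (hφ.pos _ ha)
    simp only [hct'] at this
    nlinarith [min_le_right c 1]
  have h2 : t ≤ max c 1 * √(φ (max c 1)) := by
    rw [hφ.sqrt_eq hb]
    refine Real.le_sqrt_of_sq_le ?_
    have := hφ.strictMonoOn_mul_self.monotoneOn hc (show max c 1 ∈ Ioi 0 from hb)
      (le_max_left c 1)
    have h0 := mul_pos hb (hφ.pos _ hb)
    simp only [hct'] at this
    nlinarith [le_max_right c 1]
  obtain ⟨s, hs, hst⟩ := intermediate_value_Icc min_le_max (hcont.mono hsub) ⟨h1, h2⟩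
  exact ⟨s, hsub hs, hst⟩

theorem sqrtInv_pos (hφ : AdmissibleWeight φ) {t : ℝ} (ht : 0 < t) : 0 < sqrtInv φ t :=
  Function.invFunOn_mem (hφ.bijOn_sqrt.surjOn ht)

theorem sqrtInv_eq (hφ : AdmissibleWeight φ) {t : ℝ} (ht : 0 < t) :
    sqrtInv φ t * √(φ (sqrtInv φ t)) = t :=
  Function.invFunOn_eq (f := fun s => s * √(φ s)) (hφ.bijOn_sqrt.surjOn ht)

/-- The relation that defines `Λ`. -/
theorem lam_sqrt (hφ : AdmissibleWeight φ) {s : ℝ} (hs : 0 < s) :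
    Lam φ (s * √(φ s)) = -(s * deriv φ s) / (s * deriv φ s + 2 * φ s) := by
  have h : sqrtInv φ (s * √(φ s)) = s :=
    hφ.bijOn_sqrt.injOn.leftInvOn_invFunOn (show s ∈ Ioi 0 from hs)
  rw [Lam, h]

theorem sqrtInv_mono (hφ : AdmissibleWeight φ) : MonotoneOn (sqrtInv φ) (Ioi 0) := by
  intro a ha b hb hab
  refine (hφ.strictMonoOn_sqrt.le_iff_le (hφ.sqrtInv_pos ha) (hφ.sqrtInv_pos hb)).1 ?_
  simpa only [hφ.sqrtInv_eq ha, hφ.sqrtInv_eq hb] using hab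

theorem lam_eq (hφ : AdmissibleWeight φ) {t : ℝ} (ht : 0 < t) :
    Lam φ t =
      2 / (sqrtInv φ t * deriv φ (sqrtInv φ t) / φ (sqrtInv φ t) + 2) - 1 := by
  have hs := hφ.sqrtInv_pos ht
  have hp := hφ.pos _ hs
  have h1 := hφ.neg_one_lt hs
  rw [Lam]
  set s := sqrtInv φ t
  have h2 : s * deriv φ s / φ s + 2 ≠ 0 := by linarith
  have h3 : s * deriv φ s + 2 * φ s = (s * deriv φ s / φ s + 2) * φ s := by
    field_simp
  have h4 : s * deriv φ s + 2 * φ s ≠ 0 := by rw [h3]; exact mul_ne_zero h2 hp.ne'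
  rw [eq_sub_iff_add_eq, div_add_one h4, eq_div_iff h2, div_mul_eq_mul_div, div_eq_iff h4]
  field_simp
  ring

theorem ratio_sign (hφ : AdmissibleWeight φ) :
    (∀ s, 0 < s → 0 ≤ s * deriv φ s / φ s) ∨ (∀ s, 0 < s → s * deriv φ s / φ s ≤ 0) := by
  by_contra! hcon
  obtain ⟨⟨a, ha, ha'⟩, ⟨b, hb, hb'⟩⟩ := hcon
  have hpre : IsPreconnected (uIcc a b) := isPreconnected_uIcc
  have hsub : uIcc a b ⊆ Ioi 0 := fun x hx => lt_of_lt_of_le (lt_min ha hb) hx.1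
  obtain ⟨c, hc, hc0⟩ := hpre.intermediate_value left_mem_uIcc right_mem_uIcc
    (hφ.continuousOn_ratio.mono hsub) ⟨ha'.le, hb'.le⟩
  have hmin : 0 < min a b := lt_min ha hb
  have hm := hφ.monotone_abs (show min a b ∈ Ioi 0 from hmin) (hsub hc) hc.1
  simp only [hc0, abs_zero] at hm
  rcases min_choice a b with h | h <;> rw [h] at hm
  · exact absurd (abs_nonpos_iff.1 hm) ha'.ne
  · exact absurd (abs_nonpos_iff.1 hm) hb'.ne'

theorem abs_lam_le (hφ : AdmissibleWeight φ) {t : ℝ} (ht : 0 < t) : |Lam φ t| ≤ 1 := by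
  have h1 := hφ.neg_one_lt (hφ.sqrtInv_pos ht)
  rw [hφ.lam_eq ht, abs_le]
  constructor
  · have : 0 ≤ 2 / (sqrtInv φ t * deriv φ (sqrtInv φ t) / φ (sqrtInv φ t) + 2) :=
      div_nonneg (by norm_num) (by linarith)
    linarith
  · rw [sub_le_iff_le_add, div_le_iff₀ (by linarith)]
    linarith

theorem lam_monotone_or (hφ : AdmissibleWeight φ) :
    (AntitoneOn (Lam φ) (Ioi 0) ∧ ∀ t, 0 < t → Lam φ t ≤ 0) ∨
      (MonotoneOn (Lam φ) (Ioi 0) ∧ ∀ t, 0 < t → 0 ≤ Lam φ t) := by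
  rcases hφ.ratio_sign with h | h
  · refine Or.inl ⟨fun a ha b hb hab => ?_, fun t ht => ?_⟩
    · have hm := hφ.monotone_abs (hφ.sqrtInv_pos ha) (hφ.sqrtInv_pos hb)
        (hφ.sqrtInv_mono ha hb hab)
      simp only [abs_of_nonneg (h _ (hφ.sqrtInv_pos ha)),
        abs_of_nonneg (h _ (hφ.sqrtInv_pos hb))] at hm
      rw [hφ.lam_eq ha, hφ.lam_eq hb]
      have := h _ (hφ.sqrtInv_pos ha)
      gcongr
    · have := h _ (hφ.sqrtInv_pos ht)
      rw [hφ.lam_eq ht, sub_nonpos, div_le_iff₀ (by linarith)]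
      linarith
  · refine Or.inr ⟨fun a ha b hb hab => ?_, fun t ht => ?_⟩
    · have hm := hφ.monotone_abs (hφ.sqrtInv_pos ha) (hφ.sqrtInv_pos hb)
        (hφ.sqrtInv_mono ha hb hab)
      simp only [abs_of_nonpos (h _ (hφ.sqrtInv_pos ha)),
        abs_of_nonpos (h _ (hφ.sqrtInv_pos hb)), neg_le_neg_iff] at hm
      rw [hφ.lam_eq ha, hφ.lam_eq hb]
      have := hφ.neg_one_lt (hφ.sqrtInv_pos hb)
      have h2 : 0 < sqrtInv φ b * deriv φ (sqrtInv φ b) / φ (sqrtInv φ b) + 2 := by linarith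
      gcongr
    · have := h _ (hφ.sqrtInv_pos ht)
      have h1 := hφ.neg_one_lt (hφ.sqrtInv_pos ht)
      rw [hφ.lam_eq ht, sub_nonneg, le_div_iff₀ (by linarith)]
      linarith

theorem lam_sq_mono (hφ : AdmissibleWeight φ) :
    MonotoneOn (fun t => Lam φ t ^ 2) (Ioi 0) := by
  intro a ha b hb hab
  simp only
  rcases hφ.lam_monotone_or with ⟨h, h0⟩ | ⟨h, h0⟩
  · have := h ha hb hab
    nlinarith [h0 a ha, h0 b hb]
  · have := h ha hb hab
    nlinarith [h0 a ha, h0 b hb]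

/-- The limit `Λ_∞` exists. -/
theorem tendsto_lam (hφ : AdmissibleWeight φ) : Tendsto (Lam φ) atTop (𝓝 (LamInf φ)) := by
  have hpos : ∀ t : ℝ, 0 < max t 1 := fun t => lt_max_of_lt_right one_pos
  have hev : (fun t => Lam φ (max t 1)) =ᶠ[atTop] Lam φ := by
    filter_upwards [eventually_ge_atTop 1] with t ht
    rw [max_eq_left ht]
  refine tendsto_nhds_limUnder ?_
  rcases hφ.lam_monotone_or with ⟨h, -⟩ | ⟨h, -⟩
  · refine ⟨_, (tendsto_atTop_ciInf (f := fun t => Lam φ (max t 1)) ?_ ?_).congr' hev⟩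
    · exact fun a b hab => h (hpos a) (hpos b) (max_le_max hab le_rfl)
    · exact ⟨-1, by rintro _ ⟨t, rfl⟩; exact (abs_le.1 (hφ.abs_lam_le (hpos t))).1⟩
  · refine ⟨_, (tendsto_atTop_ciSup (f := fun t => Lam φ (max t 1)) ?_ ?_).congr' hev⟩
    · exact fun a b hab => h (hpos a) (hpos b) (max_le_max hab le_rfl)
    · exact ⟨1, by rintro _ ⟨t, rfl⟩; exact (abs_le.1 (hφ.abs_lam_le (hpos t))).2⟩

/-- `Λ_∞² = sup_{t > 0} Λ(t)²`. -/
theorem isLUB_lam_sq (hφ : AdmissibleWeight φ) :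
    IsLUB ((fun t => Lam φ t ^ 2) '' Ioi 0) (LamInf φ ^ 2) := by
  have ht := hφ.tendsto_lam.pow 2
  constructor
  · rintro _ ⟨a, ha, rfl⟩
    refine ge_of_tendsto ht ?_
    filter_upwards [eventually_ge_atTop a] with b hb
    exact hφ.lam_sq_mono ha (lt_of_lt_of_le ha hb) hb
  · intro c hc
    refine le_of_tendsto ht ?_
    filter_upwards [eventually_gt_atTop 0] with b hb
    exact hc ⟨b, hb, rfl⟩

end AdmissibleWeight

/-! Put `v = √φ(|u|) u`, `ω = u/|u|` and `q = sφ'(s)/φ(s)` at `s = |u|`. Where `u ≠ 0`, one has `∂v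
= √φ (∂u + (q/2) Re⟨∂u,ω⟩ ω)`, and `∂(φ(|u|)u)` has the same shape with `φ` and `q` in place of `√φ`
and `q/2`. Since `Λ(|v|) = -q/(2+q)`, the integrand `Re⟨𝒜ʰ∂ₕu, ∂ₕ(φ(|u|)u)⟩` is exactly the
algebraic form with parameter `Λ(|v|)` at `λ = ∂ₕv` (`herm_partialDeriv_weighted`).

Sufficiency is then pointwise. The condition at `λ = ω`, together with `Λ_∞² < 1`, makes `Re⟨𝒜ʰω,ω⟩`
positive, so the form is concave in its parameter. As `Λ(t)` lies between `0` and `Λ_∞`, coercivity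
at `Λ_∞` passes to every `Λ(t)` (`algForm_mul_ge`). Zeros of `u` are handled through difference
quotients (`partialDeriv_form_ge`).

Necessity uses oscillating test functions: a plateau `Rω` plus `τ⁻¹ ψ cos(τ² x_h + θ) μ`. The
perturbation tends to `0` uniformly while its `h`-derivative has size `τ`. Adding the inequalities
for two phases in quadrature, dividing by `τ²` and letting `τ → ∞` isolates the single index `h`
with `u` frozen at `Rω` (`setIntegral_frozenExcess_nonneg`). Arbitrary `ψ` gives an inequality
almost everywhere; the right `R` and `μ` turn it into the form with parameter `Λ(t)`, and `t → ∞`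
gives `Λ_∞`. The same constant `κ` serves in both directions. -/

/-! ### The algebraic form: factorisation, substitution, concavity in the parameter. -/

section HermitianForm

variable {m : ℕ}

theorem herm_add_left (x y z : CSpace m) : herm (x + y) z = herm x z + herm y z :=
  inner_add_right _ _ _

theorem herm_add_right (x y z : CSpace m) : herm x (y + z) = herm x y + herm x z :=
  inner_add_left _ _ _

theorem herm_smul_left (r : ℝ) (x y : CSpace m) : herm (r • x) y = r * herm x y :=
  inner_smul_right_eq_smul _ _ r

theorem herm_smul_right (r : ℝ) (x y : CSpace m) : herm x (r • y) = r * herm x y :=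
  inner_smul_left_eq_smul _ _ r

theorem herm_re_comm (x y : CSpace m) : (herm x y).re = (herm y x).re :=
  inner_re_symm (𝕜 := ℂ) y x

theorem herm_self_re (x : CSpace m) : (herm x x).re = ‖x‖ ^ 2 :=
  inner_self_eq_norm_sq (𝕜 := ℂ) x

theorem norm_herm_le (x y : CSpace m) : ‖herm x y‖ ≤ ‖x‖ * ‖y‖ := by
  rw [mul_comm]
  exact norm_inner_le_norm y x

theorem abs_herm_re_le (x y : CSpace m) : |(herm x y).re| ≤ ‖x‖ * ‖y‖ :=
  (Complex.abs_re_le_norm _).trans (norm_herm_le x y)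

theorem matVec_add (B : Matrix (Fin m) (Fin m) ℂ) (x y : CSpace m) :
    matVec B (x + y) = matVec B x + matVec B y := by
  simp [matVec, Matrix.mulVec_add]

theorem matVec_smul (B : Matrix (Fin m) (Fin m) ℂ) (r : ℝ) (x : CSpace m) :
    matVec B (r • x) = r • matVec B x := by
  simp [matVec, Matrix.mulVec_smul]

theorem matVec_one (x : CSpace m) : matVec 1 x = x := by
  simp [matVec]

theorem herm_matVec (B : Matrix (Fin m) (Fin m) ℂ) (x y : CSpace m) :
    herm (matVec B x) y = ∑ i, ∑ j, B i j * (x j * star (y i)) := by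
  simp [herm, matVec, PiLp.inner_apply, Matrix.mulVec, dotProduct, Finset.sum_mul, mul_assoc]

theorem norm_herm_matVec_le (B : Matrix (Fin m) (Fin m) ℂ) (x y : CSpace m) :
    ‖herm (matVec B x) y‖ ≤ (∑ i, ∑ j, ‖B i j‖) * (‖x‖ * ‖y‖) := by
  rw [herm_matVec, Finset.sum_mul]
  refine (norm_sum_le _ _).trans (Finset.sum_le_sum fun i _ => ?_)
  rw [Finset.sum_mul]
  refine (norm_sum_le _ _).trans (Finset.sum_le_sum fun j _ => ?_)
  rw [norm_mul, norm_mul, norm_star]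
  gcongr
  · exact PiLp.norm_apply_le x j
  · exact PiLp.norm_apply_le y i

/-- With `c = L Re⟨λ,ω⟩`, expanding the product `(λ + cω, λ - cω)` yields the quadratic term in `c`
with a minus sign and the antisymmetric cross term. This is the form in which derivatives of test
functions are recognised. -/
theorem algForm_eq_herm (L : ℝ) (B : Matrix (Fin m) (Fin m) ℂ) (lam ω : CSpace m) :
    algForm L B lam ω = (herm (matVec B (lam + (L * (herm lam ω).re) • ω))
      (lam - (L * (herm lam ω).re) • ω)).re := by
  rw [sub_eq_add_neg, ← neg_smul, algForm]
  simp only [matVec_add, matVec_smul, herm_add_left, herm_add_right, herm_smul_left,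
    herm_smul_right, Complex.add_re, Complex.sub_re, Complex.re_ofReal_mul]
  ring

theorem herm_add_smul_unit {ω : CSpace m} (hω : ‖ω‖ = 1) (D : CSpace m) (c : ℝ) :
    (herm (D + (c * (herm D ω).re) • ω) ω).re = (1 + c) * (herm D ω).re := by
  rw [herm_add_left, herm_smul_left, Complex.add_re, Complex.re_ofReal_mul, herm_self_re, hω]
  ring

/-- The substitution `λ = D + (q/2) Re⟨D,ω⟩ ω`. -/
theorem algForm_substitution {q : ℝ} (hq : 2 + q ≠ 0) (B : Matrix (Fin m) (Fin m) ℂ)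
    {ω : CSpace m} (hω : ‖ω‖ = 1) (D : CSpace m) :
    algForm (-q / (2 + q)) B (D + (q / 2 * (herm D ω).re) • ω) ω =
      (herm (matVec B D) (D + (q * (herm D ω).re) • ω)).re := by
  rw [algForm_eq_herm, herm_add_smul_unit hω, add_sub_assoc, add_assoc, ← add_smul, ← sub_smul]
  have h1 : q / 2 * (herm D ω).re + -q / (2 + q) * ((1 + q / 2) * (herm D ω).re) = 0 := by
    field_simp; ring
  have h2 : q / 2 * (herm D ω).re - -q / (2 + q) * ((1 + q / 2) * (herm D ω).re)
      = q * (herm D ω).re := by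
    field_simp; ring
  rw [h1, h2, zero_smul, add_zero]

theorem algForm_self (L : ℝ) (B : Matrix (Fin m) (Fin m) ℂ) {ω : CSpace m} (hω : ‖ω‖ = 1) :
    algForm L B ω ω = (1 - L ^ 2) * (herm (matVec B ω) ω).re := by
  rw [algForm, herm_self_re, hω, sub_self, Complex.zero_re]
  ring

variable {L κ : ℝ} {B : Matrix (Fin m) (Fin m) ℂ}

/-- Coercivity of the form with parameter `L` bounds `Re⟨Bλ,λ⟩` from below. -/
theorem herm_matVec_self_ge (hL : L ^ 2 < 1) (hκ : 0 ≤ κ)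
    (hB : ∀ lam ω : CSpace m, ‖ω‖ = 1 → κ * ‖lam‖ ^ 2 ≤ algForm L B lam ω) (lam : CSpace m) :
    κ * ‖lam‖ ^ 2 ≤ (herm (matVec B lam) lam).re := by
  have unit : ∀ ω : CSpace m, ‖ω‖ = 1 → κ ≤ (herm (matVec B ω) ω).re := by
    -- Testing at `λ = ω` kills the cross term and leaves the factor `1 - L² ∈ (0, 1]`.
    intro ω hω
    have h := hB ω ω hω
    rw [algForm_self L B hω, hω] at h
    nlinarith [sq_nonneg L]
  rcases eq_or_ne lam 0 with rfl | h0
  · simp [herm]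
  have hn : ‖lam‖ ≠ 0 := norm_ne_zero_iff.2 h0
  have h := unit (‖lam‖⁻¹ • lam) (by rw [norm_smul, norm_inv, norm_norm, inv_mul_cancel₀ hn])
  rw [matVec_smul, herm_smul_left, herm_smul_right, Complex.re_ofReal_mul,
    Complex.re_ofReal_mul] at h
  have h2 : 0 < ‖lam‖ ^ 2 := by positivity
  calc κ * ‖lam‖ ^ 2 ≤ ‖lam‖⁻¹ * (‖lam‖⁻¹ * (herm (matVec B lam) lam).re) * ‖lam‖ ^ 2 := by
        gcongr
    _ = _ := by field_simp

/-- The form is concave in its parameter, so coercivity passes from `L` to `θ L`. -/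
theorem algForm_mul_ge (hL : L ^ 2 < 1) (hκ : 0 ≤ κ)
    (hB : ∀ lam ω : CSpace m, ‖ω‖ = 1 → κ * ‖lam‖ ^ 2 ≤ algForm L B lam ω)
    {θ : ℝ} (h0 : 0 ≤ θ) (h1 : θ ≤ 1) (lam : CSpace m) {ω : CSpace m} (hω : ‖ω‖ = 1) :
    κ * ‖lam‖ ^ 2 ≤ algForm (θ * L) B lam ω := by
  have ha := herm_matVec_self_ge hL hκ hB lam
  have hb := herm_matVec_self_ge hL hκ hB ω
  have hc := hB lam ω hω
  have hb0 : 0 ≤ (herm (matVec B ω) ω).re := le_trans (by positivity) hb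
  -- For `f(L) = a - bL² + cL`, the deviation of `f(θL)` from the chord `(1-θ) f(0) + θ f(L)` is
  -- `θ(1-θ) b L²`, nonnegative because `b ≥ 0`.
  have key : algForm (θ * L) B lam ω = (1 - θ) * (herm (matVec B lam) lam).re
      + θ * algForm L B lam ω
      + θ * (1 - θ) * (L ^ 2 * (herm (matVec B ω) ω).re * (herm lam ω).re ^ 2) := by
    simp only [algForm]; ring
  have h2 : 0 ≤ 1 - θ := by linarith
  have h3 : 0 ≤ θ * (1 - θ) * (L ^ 2 * (herm (matVec B ω) ω).re * (herm lam ω).re ^ 2) := by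
    positivity
  rw [key]
  nlinarith [mul_le_mul_of_nonneg_left ha h2, mul_le_mul_of_nonneg_left hc h0]

/-- For the identity matrix the cross term vanishes and Cauchy–Schwarz suffices. This case later
supplies the integrability of `|∇(√φ(|u|)u)|²`. -/
theorem algForm_one_ge (L : ℝ) (lam : CSpace m) {ω : CSpace m} (hω : ‖ω‖ = 1) :
    (1 - L ^ 2) * ‖lam‖ ^ 2 ≤ algForm L 1 lam ω := by
  have h1 : (herm lam ω).re ^ 2 ≤ ‖lam‖ ^ 2 := by
    refine sq_le_sq.2 ?_
    simpa [hω] using abs_herm_re_le lam ω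
  rw [algForm]
  simp only [matVec_one, herm_self_re, hω, Complex.sub_re, herm_re_comm ω lam]
  nlinarith [sq_nonneg L]

end HermitianForm

/-! ### Position of `Λ(t)` relative to `Λ_∞`, and `Λ` through the logarithmic derivative of `φ`. -/

section Lambda

variable {φ : ℝ → ℝ}

theorem AdmissibleWeight.lamInf_sq_lt_one (hφ : AdmissibleWeight φ)
    (hΛ : sSup ((fun t => Lam φ t ^ 2) '' Ioi 0) < 1) : LamInf φ ^ 2 < 1 := by
  rwa [hφ.isLUB_lam_sq.csSup_eq (nonempty_Ioi.image _)] at hΛ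

/-- `Λ(t)` lies between `0` and `Λ_∞`. -/
theorem AdmissibleWeight.exists_lam_eq_mul (hφ : AdmissibleWeight φ) {t : ℝ} (ht : 0 < t) :
    ∃ θ : ℝ, 0 ≤ θ ∧ θ ≤ 1 ∧ Lam φ t = θ * LamInf φ := by
  have key : (LamInf φ ≤ Lam φ t ∧ Lam φ t ≤ 0) ∨ (0 ≤ Lam φ t ∧ Lam φ t ≤ LamInf φ) := by
    rcases hφ.lam_monotone_or with ⟨h, h0⟩ | ⟨h, h0⟩
    · refine Or.inl ⟨le_of_tendsto hφ.tendsto_lam ?_, h0 t ht⟩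
      filter_upwards [eventually_ge_atTop t] with b hb using h ht (ht.trans_le hb) hb
    · refine Or.inr ⟨h0 t ht, ge_of_tendsto hφ.tendsto_lam ?_⟩
      filter_upwards [eventually_ge_atTop t] with b hb using h ht (ht.trans_le hb) hb
  rcases eq_or_ne (LamInf φ) 0 with hz | hz
  · refine ⟨0, le_rfl, zero_le_one, ?_⟩
    rw [hz] at key ⊢
    rcases key with h | h <;> linarith
  · refine ⟨Lam φ t / LamInf φ, ?_, ?_, (div_mul_cancel₀ _ hz).symm⟩
    · rcases key with h | h
      · exact div_nonneg_of_nonpos h.2 (h.1.trans h.2)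
      · exact div_nonneg h.1 (h.1.trans h.2)
    · rcases key with h | h
      · exact (div_le_one_of_neg (lt_of_le_of_ne (h.1.trans h.2) hz)).2 h.1
      · exact div_le_one_of_le₀ h.2 (h.1.trans h.2)

/-- `Λ` in terms of the ratio `q(s) = s φ'(s) / φ(s)`. -/
theorem AdmissibleWeight.lam_sqrt_ratio (hφ : AdmissibleWeight φ) {s : ℝ} (hs : 0 < s) :
    Lam φ (s * √(φ s)) = -(s * deriv φ s / φ s) / (2 + s * deriv φ s / φ s) := by
  have hp := hφ.pos s hs
  have h1 := hφ.neg_one_lt hs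
  have h2 : 2 + s * deriv φ s / φ s ≠ 0 := by linarith
  have h3 : s * deriv φ s + 2 * φ s = (2 + s * deriv φ s / φ s) * φ s := by field_simp; ring
  rw [hφ.lam_sqrt hs, h3]
  field_simp

end Lambda

/-! ### Derivatives of radial multiples `g(|u|)u` away from the zeros of `u`. -/

section RadialDerivative

variable {n m : ℕ}

theorem hasDerivAt_norm_line {γ : ℝ → CSpace m} {D : CSpace m} {t : ℝ} (hγ : HasDerivAt γ D t)
    (h0 : γ t ≠ 0) :
    HasDerivAt (fun σ => ‖γ σ‖) ((herm D (‖γ t‖⁻¹ • γ t)).re) t := by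
  have h1 : HasDerivAt (fun σ => ‖γ σ‖ ^ 2) (2 * (herm D (γ t)).re) t := by
    have h := (hγ.inner ℂ hγ)
    have h2 := Complex.reCLM.hasFDerivAt.comp_hasDerivAt t h
    have e1 : (fun σ => ‖γ σ‖ ^ 2) = Complex.reCLM ∘ fun σ => inner ℂ (γ σ) (γ σ) := by
      ext σ
      exact (inner_self_eq_norm_sq (𝕜 := ℂ) (γ σ)).symm
    have e2 : Complex.reCLM (inner ℂ (γ t) D + inner ℂ D (γ t)) = 2 * (herm D (γ t)).re := by
      rw [map_add, two_mul]
      congr 1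
      exact inner_re_symm (𝕜 := ℂ) _ _
    rw [e1, ← e2]
    exact h2
  have hn : ‖γ t‖ ≠ 0 := norm_ne_zero_iff.2 h0
  have h3 := h1.sqrt (by positivity)
  simp only [Real.sqrt_sq (norm_nonneg _)] at h3
  convert h3 using 1
  rw [herm_smul_right, Complex.re_ofReal_mul]
  field_simp

theorem hasDerivAt_radial_line {γ : ℝ → CSpace m} {D : CSpace m} {t : ℝ} (hγ : HasDerivAt γ D t)
    (h0 : γ t ≠ 0) {g : ℝ → ℝ} {g' : ℝ} (hg : HasDerivAt g g' ‖γ t‖) :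
    HasDerivAt (fun σ => g ‖γ σ‖ • γ σ)
      (g ‖γ t‖ • D + (g' * ‖γ t‖ * (herm D (‖γ t‖⁻¹ • γ t)).re) • (‖γ t‖⁻¹ • γ t)) t := by
  have h := (hg.comp t (hasDerivAt_norm_line hγ h0)).smul hγ
  have hn : ‖γ t‖ ≠ 0 := norm_ne_zero_iff.2 h0
  have e : (g' * ‖γ t‖ * (herm D (‖γ t‖⁻¹ • γ t)).re) • (‖γ t‖⁻¹ • γ t) =
      (g' * (herm D (‖γ t‖⁻¹ • γ t)).re) • γ t := by
    rw [smul_smul]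
    congr 1
    field_simp
  rw [e]
  exact h

theorem hasDerivAt_partialDeriv {u : RSpace n → CSpace m} {x : RSpace n}
    (hu : DifferentiableAt ℝ u x) (h : Fin n) :
    HasDerivAt (fun t : ℝ => u (x + t • EuclideanSpace.single h 1)) (partialDeriv h u x) 0 :=
  hu.hasFDerivAt.hasLineDerivAt _

theorem partialDeriv_eq_of_hasDerivAt {u : RSpace n → CSpace m} {x : RSpace n}
    (hu : DifferentiableAt ℝ u x) {h : Fin n} {D : CSpace m}
    (hD : HasDerivAt (fun t : ℝ => u (x + t • EuclideanSpace.single h 1)) D 0) :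
    partialDeriv h u x = D :=
  (hasDerivAt_partialDeriv hu h).unique hD

theorem differentiableAt_radial {u : RSpace n → CSpace m} {x : RSpace n}
    (hu : DifferentiableAt ℝ u x) (h0 : u x ≠ 0) {g : ℝ → ℝ} (hg : DifferentiableAt ℝ g ‖u x‖) :
    DifferentiableAt ℝ (fun y => g ‖u y‖ • u y) x :=
  (hg.comp x (hu.norm ℂ h0)).smul hu

theorem partialDeriv_radial {u : RSpace n → CSpace m} {x : RSpace n}
    (hu : DifferentiableAt ℝ u x) (h0 : u x ≠ 0) {g : ℝ → ℝ} {g' : ℝ}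
    (hg : HasDerivAt g g' ‖u x‖) (h : Fin n) :
    partialDeriv h (fun y => g ‖u y‖ • u y) x = g ‖u x‖ • partialDeriv h u x +
      (g' * ‖u x‖ * (herm (partialDeriv h u x) (‖u x‖⁻¹ • u x)).re) • (‖u x‖⁻¹ • u x) := by
  refine partialDeriv_eq_of_hasDerivAt (differentiableAt_radial hu h0 hg.differentiableAt) ?_
  have e : u (x + (0 : ℝ) • EuclideanSpace.single h 1) = u x := by simp
  have := hasDerivAt_radial_line (hasDerivAt_partialDeriv hu h) (by rwa [e]) (g := g) (g' := g')
    (by rwa [e])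
  simpa only [e] using this

variable {φ : ℝ → ℝ}

theorem AdmissibleWeight.partialDeriv_weighted (hφ : AdmissibleWeight φ)
    {u : RSpace n → CSpace m} {x : RSpace n}
    (hu : DifferentiableAt ℝ u x) (h0 : u x ≠ 0) (h : Fin n) :
    partialDeriv h (weighted φ u) x = φ ‖u x‖ • (partialDeriv h u x +
      (‖u x‖ * deriv φ ‖u x‖ / φ ‖u x‖ * (herm (partialDeriv h u x) (‖u x‖⁻¹ • u x)).re) •
        (‖u x‖⁻¹ • u x)) := by
  have hs : 0 < ‖u x‖ := norm_pos_iff.2 h0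
  have hp := hφ.pos _ hs
  refine (partialDeriv_radial hu h0 (hφ.hasDerivAt hs) h).trans ?_
  rw [smul_add, smul_smul (φ ‖u x‖)]
  congr 2
  field_simp

theorem AdmissibleWeight.partialDeriv_sqrtWeighted (hφ : AdmissibleWeight φ)
    {u : RSpace n → CSpace m} {x : RSpace n}
    (hu : DifferentiableAt ℝ u x) (h0 : u x ≠ 0) (h : Fin n) :
    partialDeriv h (sqrtWeighted φ u) x = √(φ ‖u x‖) • (partialDeriv h u x +
      (‖u x‖ * deriv φ ‖u x‖ / φ ‖u x‖ / 2 * (herm (partialDeriv h u x) (‖u x‖⁻¹ • u x)).re) •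
        (‖u x‖⁻¹ • u x)) := by
  have hs : 0 < ‖u x‖ := norm_pos_iff.2 h0
  have hp := hφ.pos _ hs
  refine (partialDeriv_radial hu h0 ((hφ.hasDerivAt hs).sqrt hp.ne') h).trans ?_
  rw [smul_add, smul_smul √(φ ‖u x‖)]
  congr 2
  have h1 : 0 < √(φ ‖u x‖) := Real.sqrt_pos.2 hp
  have h2 : φ ‖u x‖ = √(φ ‖u x‖) ^ 2 := (Real.sq_sqrt hp.le).symm
  set d := √(φ ‖u x‖)
  rw [h2]
  field_simp

end RadialDerivative

/-! ### The pointwise lower bound for the integrand, zeros of `u` included. -/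

section Pointwise

variable {n m : ℕ} {φ : ℝ → ℝ}

/-- At a zero of `u` the difference quotients are values divided by `t`, and `|√φ u|² = |u| |φ u|`
holds for them exactly, so the bound is an equality of limits when `√φ(|u|)u` is differentiable. -/
theorem norm_partialDeriv_sqrtWeighted_sq_le_of_eq_zero (hφ : AdmissibleWeight φ)
    {u : RSpace n → CSpace m} {x : RSpace n} (hu : DifferentiableAt ℝ u x)
    (hw : DifferentiableAt ℝ (weighted φ u) x) (h0 : u x = 0) (h : Fin n) :
    ‖partialDeriv h (sqrtWeighted φ u) x‖ ^ 2 ≤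
      ‖partialDeriv h u x‖ * ‖partialDeriv h (weighted φ u) x‖ := by
  -- Without differentiability `fderiv` takes its default value `0`, and the bound is trivial.
  by_cases hv : DifferentiableAt ℝ (sqrtWeighted φ u) x
  swap
  · simp only [partialDeriv, fderiv_zero_of_not_differentiableAt hv]
    simpa using by positivity
  have tu := (hasDerivAt_partialDeriv hu h).tendsto_slope_zero
  have tw := (hasDerivAt_partialDeriv hw h).tendsto_slope_zero
  have tv := (hasDerivAt_partialDeriv hv h).tendsto_slope_zero
  refine (tendsto_nhds_unique (tv.norm.pow 2) ((tu.norm.mul tw.norm).congr fun t => ?_)).le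
  set e := EuclideanSpace.single h (1 : ℝ)
  simp only [zero_add, zero_smul, add_zero, weighted, sqrtWeighted, h0, smul_zero, sub_zero,
    norm_smul, Real.norm_eq_abs]
  rcases eq_or_ne (u (x + t • e)) 0 with hz | hz
  · simp [hz]
  · have hp := hφ.pos _ (norm_pos_iff.2 hz)
    rw [abs_of_pos hp, abs_of_pos (Real.sqrt_pos.2 hp), mul_pow, mul_pow, Real.sq_sqrt hp.le]
    ring

/-- The difference quotient of `φ(|u|)u` is a positive multiple of that of `u`. The multiple is the
ratio of their norms, which converges because the limit of the denominator is nonzero. -/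
theorem exists_partialDeriv_weighted_eq_smul (hφ : AdmissibleWeight φ)
    {u : RSpace n → CSpace m} {x : RSpace n} (hu : DifferentiableAt ℝ u x)
    (hw : DifferentiableAt ℝ (weighted φ u) x) (h0 : u x = 0) (h : Fin n)
    (hD : partialDeriv h u x ≠ 0) :
    ∃ c : ℝ, 0 ≤ c ∧ partialDeriv h (weighted φ u) x = c • partialDeriv h u x := by
  have tu := (hasDerivAt_partialDeriv hu h).tendsto_slope_zero
  have tw := (hasDerivAt_partialDeriv hw h).tendsto_slope_zero
  refine ⟨‖partialDeriv h (weighted φ u) x‖ / ‖partialDeriv h u x‖, by positivity, ?_⟩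
  have hquot := (tw.norm.div tu.norm (norm_ne_zero_iff.2 hD)).smul tu
  refine tendsto_nhds_unique tw (hquot.congr' ?_)
  filter_upwards [tu.eventually_ne hD] with t ht
  set e := EuclideanSpace.single h (1 : ℝ)
  simp only [zero_add, zero_smul, add_zero, weighted, h0, smul_zero, sub_zero] at ht ⊢
  have hz : u (x + t • e) ≠ 0 := fun hz => ht (by rw [hz, smul_zero])
  have ht0 : t ≠ 0 := fun hz => ht (by simp [hz])
  have hp := hφ.pos _ (norm_pos_iff.2 hz)
  have hn := norm_ne_zero_iff.2 hz
  simp only [Pi.div_apply, norm_smul, Real.norm_eq_abs, abs_of_pos hp]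
  have ht1 : |t⁻¹| ≠ 0 := abs_ne_zero.2 (inv_ne_zero ht0)
  rw [smul_comm (t⁻¹) (φ _)]
  congr 1
  field_simp

/-- The integrand of the sesquilinear form at a point where the test function does not vanish. -/
theorem AdmissibleWeight.herm_partialDeriv_weighted (hφ : AdmissibleWeight φ)
    {u : RSpace n → CSpace m} {x : RSpace n}
    (hu : DifferentiableAt ℝ u x) (h0 : u x ≠ 0) (B : Matrix (Fin m) (Fin m) ℂ) (h : Fin n) :
    (herm (matVec B (partialDeriv h u x)) (partialDeriv h (weighted φ u) x)).re =
      algForm (Lam φ (‖u x‖ * √(φ ‖u x‖))) B (partialDeriv h (sqrtWeighted φ u) x)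
        (‖u x‖⁻¹ • u x) := by
  have hs : 0 < ‖u x‖ := norm_pos_iff.2 h0
  have hp := hφ.pos _ hs
  have hω : ‖‖u x‖⁻¹ • u x‖ = 1 := by
    rw [norm_smul, norm_inv, norm_norm, inv_mul_cancel₀ hs.ne']
  have hq := hφ.neg_one_lt hs
  rw [hφ.partialDeriv_weighted hu h0, hφ.partialDeriv_sqrtWeighted hu h0, hφ.lam_sqrt_ratio hs,
    algForm_eq_herm]
  have hsub := algForm_substitution (q := ‖u x‖ * deriv φ ‖u x‖ / φ ‖u x‖) (by linarith) B hω
    (partialDeriv h u x)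
  rw [algForm_eq_herm] at hsub
  simp only [herm_smul_left, Complex.re_ofReal_mul]
  rw [herm_smul_right, Complex.re_ofReal_mul, ← hsub]
  -- The form is evaluated at `d • V`; each of the two slots of the factorised form releases one
  -- factor `d`, and `d² = φ(|u|)`.
  set d := √(φ ‖u x‖) with hd
  have hdd : φ ‖u x‖ = d * d := (Real.mul_self_sqrt hp.le).symm
  set Λ := -(‖u x‖ * deriv φ ‖u x‖ / φ ‖u x‖) / (2 + ‖u x‖ * deriv φ ‖u x‖ / φ ‖u x‖)
  set r := (herm (partialDeriv h u x + (‖u x‖ * deriv φ ‖u x‖ / φ ‖u x‖ / 2 *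
    (herm (partialDeriv h u x) (‖u x‖⁻¹ • u x)).re) • ‖u x‖⁻¹ • u x) (‖u x‖⁻¹ • u x)).re
  set V := partialDeriv h u x + (‖u x‖ * deriv φ ‖u x‖ / φ ‖u x‖ / 2 *
    (herm (partialDeriv h u x) (‖u x‖⁻¹ • u x)).re) • ‖u x‖⁻¹ • u x
  have e1 : (Λ * (d * r)) • ‖u x‖⁻¹ • u x = d • ((Λ * r) • ‖u x‖⁻¹ • u x) := by
    rw [smul_smul d]; congr 1; ring
  rw [e1, ← smul_add, ← smul_sub, matVec_smul, herm_smul_left, herm_smul_right,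
    Complex.re_ofReal_mul, Complex.re_ofReal_mul, hdd]
  ring

variable {κ : ℝ} {B : Matrix (Fin m) (Fin m) ℂ}

/-- The algebraic condition bounds the integrand from below at every point. -/
theorem AdmissibleWeight.partialDeriv_form_ge (hφ : AdmissibleWeight φ)
    (hL : LamInf φ ^ 2 < 1) (hκ : 0 ≤ κ)
    (hB : ∀ lam ω : CSpace m, ‖ω‖ = 1 → κ * ‖lam‖ ^ 2 ≤ algForm (LamInf φ) B lam ω)
    {u : RSpace n → CSpace m} {x : RSpace n} (hu : DifferentiableAt ℝ u x)
    (hw : DifferentiableAt ℝ (weighted φ u) x) (h : Fin n) :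
    κ * ‖partialDeriv h (sqrtWeighted φ u) x‖ ^ 2 ≤
      (herm (matVec B (partialDeriv h u x)) (partialDeriv h (weighted φ u) x)).re := by
  -- At a zero the two derivatives are parallel, or `∂ₕu` vanishes, so ellipticity of `B` alone is
  -- enough.
  by_cases h0 : u x = 0
  · have hv := norm_partialDeriv_sqrtWeighted_sq_le_of_eq_zero hφ hu hw h0 h
    by_cases hD : partialDeriv h u x = 0
    · rw [hD, norm_zero, zero_mul] at hv
      have h1 : (herm (matVec B (partialDeriv h u x)) (partialDeriv h (weighted φ u) x)).re = 0 := by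
        rw [hD, ← zero_smul ℝ (0 : CSpace m), matVec_smul, herm_smul_left]
        simp
      rw [h1]
      exact mul_nonpos_of_nonneg_of_nonpos hκ hv
    · obtain ⟨c, hc, hcD⟩ := exists_partialDeriv_weighted_eq_smul hφ hu hw h0 h hD
      rw [hcD, norm_smul, Real.norm_eq_abs, abs_of_nonneg hc] at hv
      rw [hcD, herm_smul_right, Complex.re_ofReal_mul]
      have h1 := herm_matVec_self_ge hL hκ hB (partialDeriv h u x)
      calc _ ≤ κ * (‖partialDeriv h u x‖ * (c * ‖partialDeriv h u x‖)) := by gcongr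
        _ = c * (κ * ‖partialDeriv h u x‖ ^ 2) := by ring
        _ ≤ _ := by gcongr
  · have hs : 0 < ‖u x‖ := norm_pos_iff.2 h0
    have hω : ‖‖u x‖⁻¹ • u x‖ = 1 := by
      rw [norm_smul, norm_inv, norm_norm, inv_mul_cancel₀ hs.ne']
    obtain ⟨θ, hθ0, hθ1, hθ⟩ :=
      hφ.exists_lam_eq_mul (mul_pos hs (Real.sqrt_pos.2 (hφ.pos _ hs)))
    rw [hφ.herm_partialDeriv_weighted hu h0, hθ]
    exact algForm_mul_ge hL hκ hB hθ0 hθ1 _ hω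

end Pointwise

/-! ### Integrability of both sides, and sufficiency of the algebraic condition. -/

section Integrability

variable {n m : ℕ} {φ : ℝ → ℝ} {Ω : Set (RSpace n)}

theorem IsC1c.differentiableAt {u : RSpace n → CSpace m} (hu : IsC1c Ω u) (x : RSpace n) :
    DifferentiableAt ℝ u x :=
  hu.1.differentiable one_ne_zero x

theorem IsC1c.continuous_partialDeriv {u : RSpace n → CSpace m} (hu : IsC1c Ω u) (h : Fin n) :
    Continuous (partialDeriv h u) :=
  (hu.1.continuous_fderiv one_ne_zero).clm_apply continuous_const

theorem partialDeriv_eq_zero_of_notMem_tsupport {u : RSpace n → CSpace m} {x : RSpace n}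
    (hx : x ∉ tsupport u) (h : Fin n) : partialDeriv h u x = 0 := by
  rw [partialDeriv, image_eq_zero_of_notMem_tsupport (fun hx' => hx (tsupport_fderiv_subset ℝ hx'))]
  rfl

theorem measurable_norm_partialDeriv_sq (u : RSpace n → CSpace m) (h : Fin n) :
    Measurable fun x => ‖partialDeriv h u x‖ ^ 2 :=
  (measurable_fderiv_apply_const ℝ u _).norm.pow_const 2

theorem integrableOn_herm_matVec (hΩ : IsOpen Ω) {A : RSpace n → Matrix (Fin m) (Fin m) ℂ}
    (hA : ∀ i j, LocallyIntegrableOn (fun x => A x i j) Ω volume)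
    {f g : RSpace n → CSpace m} (hf : Continuous f) (hg : Continuous g) {K : Set (RSpace n)}
    (hK : IsCompact K) (hKΩ : K ⊆ Ω) (hfK : ∀ x ∉ K, f x = 0) :
    IntegrableOn (fun x => herm (matVec (A x) (f x)) (g x)) Ω volume := by
  have h1 : IntegrableOn (fun x => herm (matVec (A x) (f x)) (g x)) K volume := by
    simp only [herm_matVec]
    refine integrable_finsetSum _ fun i _ => integrable_finsetSum _ fun j _ => ?_
    refine ((hA i j).integrableOn_compact_subset hKΩ hK).mul_continuousOn ?_ hK
    have c1 : Continuous fun x => f x j := (EuclideanSpace.proj (𝕜 := ℂ) j).continuous.comp hf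
    have c2 : Continuous fun x => g x i := (EuclideanSpace.proj (𝕜 := ℂ) i).continuous.comp hg
    exact (c1.mul c2.star).continuousOn
  refine h1.of_forall_sdiff_eq_zero hΩ.measurableSet fun x hx => ?_
  simp [herm_matVec, hfK x hx.2]

theorem IsC1c.integrableOn_herm (hΩ : IsOpen Ω) {A : RSpace n → Matrix (Fin m) (Fin m) ℂ}
    (hA : ∀ i j, LocallyIntegrableOn (fun x => A x i j) Ω volume)
    {u w : RSpace n → CSpace m} (hu : IsC1c Ω u) (hw : IsC1c Ω w) (h : Fin n) :
    IntegrableOn (fun x => herm (matVec (A x) (partialDeriv h u x)) (partialDeriv h w x)) Ω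
      volume :=
  integrableOn_herm_matVec hΩ hA (hu.continuous_partialDeriv h) (hw.continuous_partialDeriv h)
    hu.2.1 hu.2.2 fun _ hx => partialDeriv_eq_zero_of_notMem_tsupport hx h

/-- No regularity of `√φ(|u|)u` is assumed. The pointwise bound for the identity matrix, whose
constant is `1 - Λ_∞²`, dominates `|∂ₕ(√φ(|u|)u)|²` by a multiple of the integrable `Re⟨∂ₕu,
∂ₕ(φ(|u|)u)⟩`. -/
theorem AdmissibleWeight.integrableOn_norm_sqrtWeighted (hφ : AdmissibleWeight φ)
    (hL : LamInf φ ^ 2 < 1) (hΩ : IsOpen Ω) {u : RSpace n → CSpace m} (hu : IsC1c Ω u)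
    (hw : IsC1c Ω (weighted φ u)) (h : Fin n) :
    IntegrableOn (fun x => ‖partialDeriv h (sqrtWeighted φ u) x‖ ^ 2) Ω volume := by
  have h1 : IntegrableOn (fun x => herm (matVec 1 (partialDeriv h u x))
      (partialDeriv h (weighted φ u) x)) Ω volume :=
    hu.integrableOn_herm hΩ (A := fun _ => 1)
      (fun i j => (continuous_const.locallyIntegrable).locallyIntegrableOn _) hw h
  have h2 : 0 < 1 - LamInf φ ^ 2 := by linarith
  refine (h1.re.const_mul (1 - LamInf φ ^ 2)⁻¹).mono'
    (measurable_norm_partialDeriv_sq _ h).aestronglyMeasurable (Eventually.of_forall fun x => ?_)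
  rw [Real.norm_of_nonneg (by positivity), ← div_eq_inv_mul, le_div_iff₀ h2, mul_comm]
  exact hφ.partialDeriv_form_ge hL h2.le (fun lam ω hω => algForm_one_ge _ lam hω)
    (hu.differentiableAt x) (hw.differentiableAt x) h

variable {𝒜 : Fin n → RSpace n → Matrix (Fin m) (Fin m) ℂ}

theorem strictDissipative_of_algForm_ge (hφ : AdmissibleWeight φ) (hL : LamInf φ ^ 2 < 1)
    (hΩ : IsOpen Ω) (h𝒜 : ∀ h i j, LocallyIntegrableOn (fun x => 𝒜 h x i j) Ω volume)
    {κ : ℝ} (hκ : 0 < κ)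
    (hB : ∀ᵐ x ∂(volume.restrict Ω), ∀ (h : Fin n) (lam ω : CSpace m),
        ‖ω‖ = 1 → κ * ‖lam‖ ^ 2 ≤ algForm (LamInf φ) (𝒜 h x) lam ω) :
    StrictDissipative φ Ω 𝒜 := by
  refine ⟨κ, hκ, fun u hu hw => ?_⟩
  have hint : IntegrableOn (fun x => ∑ h, herm (matVec (𝒜 h x) (partialDeriv h u x))
      (partialDeriv h (weighted φ u) x)) Ω volume :=
    integrable_finsetSum _ fun h _ => hu.integrableOn_herm hΩ (h𝒜 h) hw h
  have hre := integral_re hint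
  simp only [RCLike.re_to_complex] at hre
  rw [← hre, ← integral_const_mul]
  refine integral_mono_ae ((integrable_finsetSum _ fun h _ =>
    hφ.integrableOn_norm_sqrtWeighted hL hΩ hu hw h).const_mul κ) hint.re ?_
  filter_upwards [hB] with x hx
  simp only [Complex.re_sum, Finset.mul_sum]
  exact Finset.sum_le_sum fun h _ => hφ.partialDeriv_form_ge hL hκ.le (hx h)
    (hu.differentiableAt x) (hw.differentiableAt x) h

end Integrability

/-! ### From integrals against squared cutoffs to inequalities almost everywhere. -/

section Localization

variable {n : ℕ} {Ω : Set (RSpace n)}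

/-- A smooth cutoff function between a compact set and an open neighbourhood of it. -/
theorem exists_cutoff {K U : Set (RSpace n)} (hK : IsCompact K) (hU : IsOpen U) (hKU : K ⊆ U) :
    ∃ η : RSpace n → ℝ, ContDiff ℝ 1 η ∧ HasCompactSupport η ∧ tsupport η ⊆ U ∧
      (∀ x, η x ∈ Icc (0 : ℝ) 1) ∧ ∀ᶠ x in 𝓝ˢ K, η x = 1 := by
  obtain ⟨K', hK', hKK', hK'U⟩ := exists_compact_between hK hU hKU
  obtain ⟨f, hf1, hf0, hf⟩ := exists_contMDiffMap_one_nhds_of_subset_interior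
    (n := 1) (modelWithCornersSelf ℝ (RSpace n)) hK.isClosed hKK'
  have hsupp : Function.support f ⊆ K' := fun x hx => by
    by_contra h
    exact hx (hf0 x h)
  exact ⟨f, f.contMDiff.contDiff, HasCompactSupport.of_support_subset_isCompact hK' hsupp,
    (closure_minimal hsupp hK'.isClosed).trans hK'U, hf, hf1⟩

/-- Cutoffs equal to `1` on `K` and supported in shrinking neighbourhoods have squares converging
pointwise to the indicator of `K`; `|f|` on one fixed compact thickening dominates. -/
theorem setIntegral_nonneg_of_forall_cutoff (hΩ : IsOpen Ω) {f : RSpace n → ℝ}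
    (hf : LocallyIntegrableOn f Ω volume)
    (h : ∀ ψ : RSpace n → ℝ, ContDiff ℝ 1 ψ → HasCompactSupport ψ → tsupport ψ ⊆ Ω →
      0 ≤ ∫ x in Ω, ψ x ^ 2 * f x) {K : Set (RSpace n)} (hK : IsCompact K) (hKΩ : K ⊆ Ω) :
    0 ≤ ∫ x in K, f x := by
  obtain ⟨δ, δpos, hδ⟩ := hK.exists_cthickening_subset_open hΩ hKΩ
  have hcomp : IsCompact (Metric.cthickening δ K) := hK.cthickening
  obtain ⟨s, -, s_pos, s_lim⟩ := exists_seq_strictAnti_tendsto' δpos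
  have hg : ∀ k, ∃ η : RSpace n → ℝ, ContDiff ℝ 1 η ∧ HasCompactSupport η ∧
      tsupport η ⊆ Metric.thickening (s k) K ∧
      (∀ x, η x ∈ Icc (0 : ℝ) 1) ∧ ∀ᶠ x in 𝓝ˢ K, η x = 1 := fun k =>
    exists_cutoff hK Metric.isOpen_thickening (Metric.self_subset_thickening (s_pos k).1 K)
  choose g g_diff g_comp g_supp g_range g_one using hg
  have hsub : ∀ k, tsupport (g k) ⊆ Metric.cthickening δ K := fun k =>
    (g_supp k).trans (Metric.thickening_subset_cthickening_of_le (s_pos k).2.le K)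
  have hlim : Tendsto (fun k => ∫ x in Ω, g k x ^ 2 * f x) atTop
      (𝓝 (∫ x in Ω, K.indicator f x)) := by
    refine tendsto_integral_of_dominated_convergence
      ((Metric.cthickening δ K).indicator fun x => ‖f x‖) (fun k => ?_) ?_ (fun k => ?_) ?_
    · exact ((g_diff k).continuous.pow 2).aestronglyMeasurable.mul hf.aestronglyMeasurable
    · rw [integrable_indicator_iff hcomp.measurableSet]
      refine IntegrableOn.mono_measure ?_ Measure.restrict_le_self
      exact (hf.integrableOn_compact_subset hδ hcomp).norm
    · refine Eventually.of_forall fun x => ?_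
      refine le_indicator_apply (fun _ => ?_) fun hx => ?_
      · have h1 := g_range k x
        rw [norm_mul]
        refine mul_le_of_le_one_left (norm_nonneg _) ?_
        rw [Real.norm_of_nonneg (sq_nonneg _)]
        exact pow_le_one₀ h1.1 h1.2
      · rw [image_eq_zero_of_notMem_tsupport fun hx' => hx (hsub k hx')]
        simp
    · refine Eventually.of_forall fun x => ?_
      by_cases hx : x ∈ K
      · have h1 : ∀ k, g k x = 1 := fun k => (g_one k).self_of_nhdsSet x hx
        simp [h1, hx]
      · rw [indicator_of_notMem hx]
        refine tendsto_const_nhds.congr' ?_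
        obtain ⟨ε, εpos, hε⟩ : ∃ ε, 0 < ε ∧ x ∉ Metric.thickening ε K := by
          rw [← hK.isClosed.closure_eq, Metric.closure_eq_iInter_thickening K] at hx
          simpa using hx
        filter_upwards [(tendsto_order.1 s_lim).2 _ εpos] with k hk
        rw [image_eq_zero_of_notMem_tsupport
          fun hx' => hε (Metric.thickening_mono hk.le K (g_supp k hx'))]
        simp
  rw [setIntegral_indicator hK.measurableSet, inter_eq_self_of_subset_right hKΩ] at hlim
  exact ge_of_tendsto' hlim fun k => h (g k) (g_diff k) (g_comp k) ((hsub k).trans hδ)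

/-- If `f < 0` on a set of positive measure, inner regularity puts a compact set of positive measure
inside it, over which the integral is negative. A measurable representative `g` makes that set
measurable. -/
theorem ae_nonneg_of_forall_setIntegral_isCompact_nonneg (hΩ : IsOpen Ω) {f : RSpace n → ℝ}
    (hf : LocallyIntegrableOn f Ω volume)
    (h : ∀ K, IsCompact K → K ⊆ Ω → 0 ≤ ∫ x in K, f x) :
    ∀ᵐ x ∂(volume.restrict Ω), 0 ≤ f x := by
  have hmeas := hf.aestronglyMeasurable
  set g := hmeas.mk f with hg
  have hgm : Measurable g := hmeas.stronglyMeasurable_mk.measurable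
  have hfg : f =ᵐ[volume.restrict Ω] g := hmeas.ae_eq_mk
  set N := {x | g x < 0} ∩ Ω with hN
  have hNm : MeasurableSet N := (measurableSet_lt hgm measurable_const).inter hΩ.measurableSet
  have hN0 : volume N = 0 := by
    by_contra hne
    obtain ⟨K, hKN, hK, hKpos⟩ := hNm.exists_lt_isCompact (pos_iff_ne_zero.2 hne)
    have hKΩ : K ⊆ Ω := hKN.trans inter_subset_right
    have hfgK : f =ᵐ[volume.restrict K] g :=
      ae_mono (Measure.restrict_mono hKΩ le_rfl) hfg
    have h1 := h K hK hKΩ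
    rw [integral_congr_ae hfgK] at h1
    have hgi : IntegrableOn g K volume :=
      (hf.integrableOn_compact_subset hKΩ hK).congr hfgK
    have h2 : 0 < ∫ x in K, -g x := by
      rw [setIntegral_pos_iff_support_of_nonneg_ae]
      · refine hKpos.trans_le (measure_mono fun x hx => ⟨?_, hx⟩)
        have : g x < 0 := (hKN hx).1
        simp [this.ne]
      · refine (ae_restrict_iff' hK.measurableSet).2 (Eventually.of_forall fun x hx => ?_)
        have : g x < 0 := (hKN hx).1
        simpa using this.le
      · exact hgi.neg
    rw [integral_neg] at h2
    linarith
  have hae : ∀ᵐ x ∂(volume.restrict Ω), x ∉ N :=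
    ae_restrict_of_ae (measure_eq_zero_iff_ae_notMem.1 hN0)
  filter_upwards [hfg, hae, ae_restrict_mem hΩ.measurableSet] with x h1 h2 h3
  rw [h1]
  by_contra h4
  exact h2 ⟨not_le.1 h4, h3⟩

theorem ae_nonneg_of_forall_cutoff (hΩ : IsOpen Ω) {f : RSpace n → ℝ}
    (hf : LocallyIntegrableOn f Ω volume)
    (h : ∀ ψ : RSpace n → ℝ, ContDiff ℝ 1 ψ → HasCompactSupport ψ → tsupport ψ ⊆ Ω →
      0 ≤ ∫ x in Ω, ψ x ^ 2 * f x) :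
    ∀ᵐ x ∂(volume.restrict Ω), 0 ≤ f x :=
  ae_nonneg_of_forall_setIntegral_isCompact_nonneg hΩ hf fun _ hK hKΩ =>
    setIntegral_nonneg_of_forall_cutoff hΩ hf h hK hKΩ

end Localization

/-! ### A profile with which the plateau descends to zero while `φ(|u|)u` stays `C¹`. -/

section Profile

variable {φ : ℝ → ℝ}

theorem AdmissibleWeight.exists_mul_self_lt (hφ : AdmissibleWeight φ) {ε : ℝ} (hε : 0 < ε) :
    ∃ δ, 0 < δ ∧ ∀ s, 0 < s → s < δ → s * φ s < ε := by
  obtain ⟨δ, hδ, hδε⟩ : ε ∈ (fun s => s * φ s) '' Ioi 0 := by rw [hφ.range_eq]; exact hε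
  exact ⟨δ, hδ, fun s hs hsδ => (hφ.strictMonoOn_mul_self hs hδ hsδ).trans_eq hδε⟩

/-- A power profile flattens the weight at the origin. -/
theorem AdmissibleWeight.exists_contDiff_profile (hφ : AdmissibleWeight φ) {R : ℝ} (hR : 0 < R) :
    ∃ p : ℕ, 0 < p ∧ ∃ G : ℝ → ℝ, ContDiff ℝ 1 G ∧
      ∀ y, 0 ≤ y → G y = φ (R * y ^ p) * (R * y ^ p) := by
  obtain ⟨C₁, C₂, r, s₀, hC₁, hC₂, hr, hs₀, hbd, -, -⟩ := hφ.growth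
  -- With `F(s) = sφ(s)` and `F'(s) ≤ C₂ s^r`, the derivative of `F(R y^p)` is `O(y^(p(r+1)-1))`;
  -- `p(r+1) > 2` makes it `O(y)`, hence zero at the origin.
  obtain ⟨p, hp⟩ := exists_nat_gt (max 1 (2 / (r + 1)))
  have hp1 : (1 : ℝ) < p := (le_max_left _ _).trans_lt hp
  have hp0 : 0 < p := by
    have : (0 : ℝ) < p := by linarith
    exact_mod_cast this
  have hpr : 2 < p * (r + 1) := by
    have := (le_max_right _ _).trans_lt hp
    rwa [div_lt_iff₀ (by linarith)] at this
  let P : ℝ → ℝ := fun y => R * y ^ p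
  let F : ℝ → ℝ := fun s => s * φ s
  let G : ℝ → ℝ := fun y => if 0 < y then F (P y) else 0
  let g : ℝ → ℝ := fun y => if 0 < y then deriv F (P y) * (R * (p * y ^ (p - 1))) else 0
  have hPpos : ∀ y, 0 < y → 0 < P y := fun y hy => mul_pos hR (pow_pos hy p)
  have hPcont : Continuous P := continuous_const.mul (continuous_pow p)
  have hP0 : P 0 = 0 := by simp [P, hp0.ne']
  have hFd : ContinuousOn (deriv F) (Ioi 0) := by
    have : ContDiffOn ℝ 1 F (Ioi 0) := contDiffOn_id.mul hφ.contDiffOn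
    exact this.continuousOn_deriv_of_isOpen isOpen_Ioi le_rfl
  have hFderiv : ∀ s, 0 < s → HasDerivAt F (deriv F s) s := fun s hs =>
    (differentiableAt_id.mul (hφ.hasDerivAt hs).differentiableAt).hasDerivAt
  have hGc : ContinuousAt G 0 := by
    have hG0 : G 0 = 0 := if_neg (lt_irrefl _)
    rw [Metric.continuousAt_iff]
    intro ε hε
    obtain ⟨δ, hδ, hδε⟩ := hφ.exists_mul_self_lt hε
    obtain ⟨δ', hδ', h'⟩ := Metric.continuousAt_iff.1 hPcont.continuousAt δ hδ
    refine ⟨δ', hδ', fun y hy => ?_⟩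
    have h1 := h' hy
    rw [hP0, Real.dist_0_eq_abs] at h1
    rw [hG0, Real.dist_0_eq_abs]
    by_cases hy0 : 0 < y
    · have h2 := hδε (P y) (hPpos y hy0) (lt_of_abs_lt h1)
      simp only [G, if_pos hy0]
      rw [abs_of_pos (mul_pos (hPpos y hy0) (hφ.pos _ (hPpos y hy0)))]
      exact h2
    · simpa [G, hy0] using hε
  have hgc0 : ContinuousAt g 0 := by
    have hg0 : g 0 = 0 := if_neg (lt_irrefl _)
    have hbound : ∀ᶠ y in 𝓝 (0 : ℝ), ‖g y‖ ≤ C₂ * R ^ r * R * p * |y| := by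
      have e1 : ∀ᶠ y in 𝓝 (0 : ℝ), P y < s₀ :=
        hPcont.continuousAt.eventually_lt continuousAt_const (by rwa [hP0])
      filter_upwards [e1, Iio_mem_nhds one_pos] with y h1 h2
      by_cases hy0 : 0 < y
      · have h3 := hbd (P y) ⟨hPpos y hy0, h1⟩
        have h4 := hφ.deriv_pos (P y) (hPpos y hy0)
        simp only [g, if_pos hy0]
        rw [abs_of_pos hy0, Real.norm_of_nonneg (by positivity)]
        have h5 : (P y) ^ r = R ^ r * y ^ (p * r) := by
          simp only [P]
          rw [Real.mul_rpow hR.le (by positivity), ← Real.rpow_natCast y p, ← Real.rpow_mul hy0.le]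
        have h6 : y ^ (p * r) * y ^ (p - 1) ≤ y := by
          rw [← Real.rpow_natCast y (p - 1), ← Real.rpow_add hy0]
          nth_rw 2 [← Real.rpow_one y]
          refine Real.rpow_le_rpow_of_exponent_ge hy0 (le_of_lt h2) ?_
          rw [Nat.cast_sub hp0]
          push_cast
          linarith
        calc deriv F (P y) * (R * (p * y ^ (p - 1)))
            ≤ C₂ * (P y) ^ r * (R * (p * y ^ (p - 1))) := by
              gcongr
              exact h3.2
          _ = C₂ * R ^ r * R * p * (y ^ (p * r) * y ^ (p - 1)) := by rw [h5]; ring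
          _ ≤ _ := by gcongr
      · simp only [g, if_neg hy0, norm_zero]
        positivity
    have hz : Tendsto (fun y : ℝ => C₂ * R ^ r * R * p * |y|) (𝓝 0) (𝓝 0) := by
      have : Continuous fun y : ℝ => C₂ * R ^ r * R * p * |y| := by fun_prop
      simpa using this.tendsto 0
    rw [ContinuousAt, hg0]
    exact squeeze_zero_norm' hbound hz
  have hderiv : ∀ y ≠ 0, HasDerivAt G (g y) y := by
    intro y hy
    rcases lt_or_gt_of_ne hy with hneg | hpos
    · have : G =ᶠ[𝓝 y] fun _ => 0 := by
        filter_upwards [Iio_mem_nhds hneg] with z hz using if_neg (not_lt.2 (le_of_lt hz))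
      simp only [g, if_neg (not_lt.2 hneg.le)]
      exact (hasDerivAt_const y (0 : ℝ)).congr_of_eventuallyEq this
    · have : G =ᶠ[𝓝 y] F ∘ P := by
        filter_upwards [Ioi_mem_nhds hpos] with z hz using if_pos hz
      simp only [g, if_pos hpos]
      exact ((hFderiv _ (hPpos y hpos)).comp y
        ((hasDerivAt_pow p y).const_mul R)).congr_of_eventuallyEq this
  -- Differentiability at `0` comes from continuity of `G` there and convergence of its derivative.
  have hall : ∀ y, HasDerivAt G (g y) y := fun y =>
    hasDerivAt_of_hasDerivAt_of_ne' hderiv hGc hgc0 y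
  have hgcont : Continuous g := by
    refine continuous_iff_continuousAt.2 fun y => ?_
    rcases lt_trichotomy y 0 with hneg | rfl | hpos
    · refine (continuousAt_const (y := (0 : ℝ))).congr ?_
      filter_upwards [Iio_mem_nhds hneg] with z hz using (if_neg (not_lt.2 (le_of_lt hz))).symm
    · exact hgc0
    · have h1 : ContinuousAt (fun z => deriv F (P z) * (R * (p * z ^ (p - 1)))) y := by
        refine ContinuousAt.mul ?_ (by fun_prop)
        exact ContinuousAt.comp (g := deriv F) (hFd.continuousAt (Ioi_mem_nhds (hPpos y hpos)))
          hPcont.continuousAt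
      refine h1.congr ?_
      filter_upwards [Ioi_mem_nhds hpos] with z hz using (if_pos hz).symm
  refine ⟨p, hp0, G, ?_, fun y hy => ?_⟩
  · rw [contDiff_one_iff_deriv]
    refine ⟨fun y => (hall y).differentiableAt, ?_⟩
    rwa [show deriv G = g from funext fun y => (hall y).deriv]
  · rcases hy.eq_or_lt with rfl | hpos
    · simp [G, hp0.ne']
    · simp only [G, if_pos hpos, F, P]
      ring

end Profile

/-! ### The oscillating test functions and their admissibility. -/

section Oscillation

variable {n m : ℕ}

/-- The scalar amplitude `ψ(x) cos(τ² x_h + θ) / τ`. -/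
noncomputable def oscAmp (ψ : RSpace n → ℝ) (h : Fin n) (τ θ : ℝ) (x : RSpace n) : ℝ :=
  ψ x * Real.cos (τ ^ 2 * x h + θ) / τ

/-- The rescaled derivative `τ⁻¹ ∂ₖ` of `oscAmp`. -/
noncomputable def oscSlope (ψ : RSpace n → ℝ) (h : Fin n) (τ θ : ℝ) (k : Fin n)
    (x : RSpace n) : ℝ :=
  fderiv ℝ ψ x (EuclideanSpace.single k 1) * Real.cos (τ ^ 2 * x h + θ) / τ ^ 2 -
    ψ x * Real.sin (τ ^ 2 * x h + θ) * (if h = k then 1 else 0)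

/-- A plateau `R η^p ω` perturbed by a fast small oscillation in the direction `μ`. -/
noncomputable def oscTest (R : ℝ) (p : ℕ) (η ψ : RSpace n → ℝ) (h : Fin n) (ω μ : CSpace m)
    (τ θ : ℝ) (x : RSpace n) : CSpace m :=
  (R * η x ^ p) • ω + oscAmp ψ h τ θ x • μ

variable {ψ η : RSpace n → ℝ} {h k : Fin n} {τ θ R M : ℝ} {p : ℕ} {ω μ : CSpace m}

theorem contDiff_oscAmp (hψ : ContDiff ℝ 1 ψ) : ContDiff ℝ 1 (oscAmp ψ h τ θ) := by
  have h1 : ContDiff ℝ 1 fun x : RSpace n => x h :=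
    (EuclideanSpace.proj (𝕜 := ℝ) h).contDiff
  exact (hψ.mul (Real.contDiff_cos.comp ((contDiff_const.mul h1).add contDiff_const))).div_const _

theorem abs_oscAmp_le (hM : ∀ x, |ψ x| ≤ M) (hτ : 0 < τ) (x : RSpace n) :
    |oscAmp ψ h τ θ x| ≤ M / τ := by
  rw [oscAmp, abs_div, abs_of_pos hτ, abs_mul]
  gcongr
  exact (mul_le_of_le_one_right (abs_nonneg _) (Real.abs_cos_le_one _)).trans (hM x)

theorem abs_oscSlope_le (hM : ∀ x, |ψ x| ≤ M)
    (hM' : ∀ x, ∀ k, |fderiv ℝ ψ x (EuclideanSpace.single k 1)| ≤ M) (hτ : 1 ≤ τ)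
    (x : RSpace n) : |oscSlope ψ h τ θ k x| ≤ 2 * M := by
  have hM0 : 0 ≤ M := (abs_nonneg _).trans (hM x)
  have h1 : |fderiv ℝ ψ x (EuclideanSpace.single k 1) * Real.cos (τ ^ 2 * x h + θ) / τ ^ 2| ≤ M := by
    rw [abs_div, abs_mul, abs_of_pos (by positivity : 0 < τ ^ 2)]
    refine div_le_of_le_mul₀ (by positivity) hM0 ?_
    exact mul_le_mul (hM' x k) ((Real.abs_cos_le_one _).trans (one_le_pow₀ hτ)) (abs_nonneg _) hM0
  have h2 : |ψ x * Real.sin (τ ^ 2 * x h + θ) * (if h = k then 1 else 0)| ≤ M := by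
    rw [abs_mul, abs_mul]
    refine (mul_le_of_le_one_right (by positivity) ?_).trans
      ((mul_le_of_le_one_right (abs_nonneg _) (Real.abs_sin_le_one _)).trans (hM x))
    split_ifs <;> simp
  have h3 := abs_sub (fderiv ℝ ψ x (EuclideanSpace.single k 1) * Real.cos (τ ^ 2 * x h + θ) / τ ^ 2)
    (ψ x * Real.sin (τ ^ 2 * x h + θ) * (if h = k then 1 else 0))
  rw [oscSlope]
  linarith

theorem hasDerivAt_oscAmp_line (hψ : ContDiff ℝ 1 ψ) (hτ : τ ≠ 0) (k : Fin n) (x : RSpace n) :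
    HasDerivAt (fun t : ℝ => oscAmp ψ h τ θ (x + t • EuclideanSpace.single k 1))
      (τ * oscSlope ψ h τ θ k x) 0 := by
  have h1 : HasDerivAt (fun t : ℝ => ψ (x + t • EuclideanSpace.single k 1))
      (fderiv ℝ ψ x (EuclideanSpace.single k 1)) 0 :=
    (hψ.differentiable one_ne_zero x).hasFDerivAt.hasLineDerivAt _
  have h2 : HasDerivAt
      (fun t : ℝ => τ ^ 2 * (x + t • EuclideanSpace.single k (1 : ℝ)) h + θ)
      (τ ^ 2 * (if h = k then 1 else 0)) 0 := by
    have e : (fun t : ℝ => τ ^ 2 * (x + t • EuclideanSpace.single k (1 : ℝ)) h + θ) =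
        fun t => τ ^ 2 * (x h + t * (if h = k then 1 else 0)) + θ := by
      ext t
      simp
    rw [e]
    have := ((((hasDerivAt_id (0 : ℝ)).mul_const (if h = k then (1 : ℝ) else 0)).const_add
      (x h)).const_mul (τ ^ 2)).add_const θ
    simpa using this
  have h3 := (h1.mul h2.cos).div_const τ
  have e : τ * oscSlope ψ h τ θ k x = (fderiv ℝ ψ x (EuclideanSpace.single k 1) *
      Real.cos (τ ^ 2 * (x + (0 : ℝ) • EuclideanSpace.single k (1 : ℝ)) h + θ) +
      ψ (x + (0 : ℝ) • EuclideanSpace.single k 1) *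
      (-Real.sin (τ ^ 2 * (x + (0 : ℝ) • EuclideanSpace.single k (1 : ℝ)) h + θ) *
      (τ ^ 2 * (if h = k then 1 else 0)))) / τ := by
    simp only [zero_smul, add_zero, oscSlope]
    field_simp
    ring
  rw [e]
  exact h3

theorem contDiff_oscTest (hη : ContDiff ℝ 1 η) (hψ : ContDiff ℝ 1 ψ) :
    ContDiff ℝ 1 (oscTest R p η ψ h ω μ τ θ) :=
  ((contDiff_const.mul (hη.pow p)).smul contDiff_const).add
    ((contDiff_oscAmp hψ).smul contDiff_const)

theorem oscTest_eventuallyEq_plateau (h1 : ∀ᶠ x in 𝓝ˢ (tsupport ψ), η x = 1) {x : RSpace n}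
    (hx : x ∈ tsupport ψ) :
    oscTest R p η ψ h ω μ τ θ =ᶠ[𝓝 x] fun y => R • ω + oscAmp ψ h τ θ y • μ := by
  filter_upwards [h1.filter_mono (nhds_le_nhdsSet hx)] with y hy
  simp [oscTest, hy]

theorem oscTest_eventuallyEq_base {x : RSpace n} (hx : x ∉ tsupport ψ) :
    oscTest R p η ψ h ω μ τ θ =ᶠ[𝓝 x] fun y => (R * η y ^ p) • ω := by
  filter_upwards [(isClosed_tsupport ψ).isOpen_compl.mem_nhds hx] with y hy
  simp [oscTest, oscAmp, image_eq_zero_of_notMem_tsupport hy]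

theorem partialDeriv_oscTest (hψ : ContDiff ℝ 1 ψ) (h1 : ∀ᶠ x in 𝓝ˢ (tsupport ψ), η x = 1)
    (hτ : τ ≠ 0) {x : RSpace n} (hx : x ∈ tsupport ψ) :
    partialDeriv k (oscTest R p η ψ h ω μ τ θ) x = (τ * oscSlope ψ h τ θ k x) • μ := by
  rw [partialDeriv, (oscTest_eventuallyEq_plateau h1 hx).fderiv_eq]
  refine partialDeriv_eq_of_hasDerivAt
    (u := fun y => R • ω + oscAmp ψ h τ θ y • μ) ?_ ?_
  · exact (((contDiff_oscAmp hψ).differentiable one_ne_zero x).smul_const μ).const_add _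
  · exact ((hasDerivAt_oscAmp_line hψ hτ k x).smul_const μ).const_add _

theorem tsupport_oscTest_subset (hp : 0 < p) (h1 : ∀ᶠ x in 𝓝ˢ (tsupport ψ), η x = 1) :
    tsupport (oscTest R p η ψ h ω μ τ θ) ⊆ tsupport η := by
  refine closure_minimal (fun x hx => ?_) (isClosed_tsupport η)
  by_contra hxη
  have h2 : η x = 0 := image_eq_zero_of_notMem_tsupport hxη
  have h3 : x ∉ tsupport ψ := fun h3 => by
    have := h1.self_of_nhdsSet x h3
    rw [h2] at this
    exact zero_ne_one this
  exact hx (by simp [oscTest, oscAmp, h2, hp.ne', image_eq_zero_of_notMem_tsupport h3])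

theorem isC1c_oscTest {Ω : Set (RSpace n)} (hη : ContDiff ℝ 1 η) (hψ : ContDiff ℝ 1 ψ)
    (hηc : HasCompactSupport η) (hηΩ : tsupport η ⊆ Ω) (hp : 0 < p)
    (h1 : ∀ᶠ x in 𝓝ˢ (tsupport ψ), η x = 1) :
    IsC1c Ω (oscTest R p η ψ h ω μ τ θ) :=
  ⟨contDiff_oscTest hη hψ, hηc.of_isClosed_subset (isClosed_tsupport _)
    (tsupport_oscTest_subset hp h1), (tsupport_oscTest_subset hp h1).trans hηΩ⟩

/-- On the support of `ψ` the values stay in a fixed compact ball that avoids `0`. There `φ` is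
regular, and bounds can be taken uniform in `τ`. -/
theorem oscTest_apply_mem_closedBall (hM : ∀ x, |ψ x| ≤ M) (hτ : 0 < τ)
    (hτM : M / τ * ‖μ‖ ≤ R / 2) (h1 : ∀ᶠ x in 𝓝ˢ (tsupport ψ), η x = 1) {x : RSpace n}
    (hx : x ∈ tsupport ψ) :
    oscTest R p η ψ h ω μ τ θ x ∈ Metric.closedBall (R • ω) (R / 2) := by
  rw [(oscTest_eventuallyEq_plateau h1 hx).eq_of_nhds, mem_closedBall_iff_norm,
    add_sub_cancel_left, norm_smul]
  exact (mul_le_mul_of_nonneg_right (abs_oscAmp_le hM hτ x) (norm_nonneg _)).trans hτM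

theorem ne_zero_of_mem_closedBall_smul (hω : ‖ω‖ = 1) (hR : 0 < R) {z : CSpace m}
    (hz : z ∈ Metric.closedBall (R • ω) (R / 2)) : z ≠ 0 := by
  rintro rfl
  rw [mem_closedBall_iff_norm, zero_sub, norm_neg, norm_smul, hω, Real.norm_of_nonneg hR.le] at hz
  linarith

variable {φ : ℝ → ℝ}

theorem AdmissibleWeight.contDiffAt_weighted (hφ : AdmissibleWeight φ) {u : RSpace n → CSpace m}
    {x : RSpace n} (hu : ContDiffAt ℝ 1 u x) (h0 : u x ≠ 0) : ContDiffAt ℝ 1 (weighted φ u) x :=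
  ((hφ.contDiffOn.contDiffAt (Ioi_mem_nhds (norm_pos_iff.2 h0))).comp x (hu.norm ℂ h0)).smul hu

theorem weighted_eventuallyEq {u v : RSpace n → CSpace m} {x : RSpace n} (h : u =ᶠ[𝓝 x] v) :
    weighted φ u =ᶠ[𝓝 x] weighted φ v := by
  filter_upwards [h] with y hy
  simp [weighted, hy]

theorem sqrtWeighted_eventuallyEq {u v : RSpace n → CSpace m} {x : RSpace n} (h : u =ᶠ[𝓝 x] v) :
    sqrtWeighted φ u =ᶠ[𝓝 x] sqrtWeighted φ v := by
  filter_upwards [h] with y hy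
  simp [sqrtWeighted, hy]

/-- On the support of `ψ` the test function does not vanish, so `φ(|u|)u` is as regular as `φ`.
Elsewhere only the plateau remains and `φ(|u|)u = G(η) ω` with the `C¹` profile `G`. -/
theorem AdmissibleWeight.isC1c_weighted_oscTest (hφ : AdmissibleWeight φ) {Ω : Set (RSpace n)}
    {G : ℝ → ℝ} (hG : ContDiff ℝ 1 G) (hGφ : ∀ y, 0 ≤ y → G y = φ (R * y ^ p) * (R * y ^ p))
    (hη : ContDiff ℝ 1 η) (hψ : ContDiff ℝ 1 ψ)
    (hηc : HasCompactSupport η) (hηΩ : tsupport η ⊆ Ω) (hη0 : ∀ x, 0 ≤ η x) (hp : 0 < p)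
    (h1 : ∀ᶠ x in 𝓝ˢ (tsupport ψ), η x = 1) (hω : ‖ω‖ = 1) (hR : 0 < R)
    (hM : ∀ x, |ψ x| ≤ M) (hτ : 0 < τ) (hτM : M / τ * ‖μ‖ ≤ R / 2) :
    IsC1c Ω (weighted φ (oscTest R p η ψ h ω μ τ θ)) := by
  have hu : IsC1c Ω (oscTest R p η ψ h ω μ τ θ) := isC1c_oscTest hη hψ hηc hηΩ hp h1
  have hsub : tsupport (weighted φ (oscTest R p η ψ h ω μ τ θ)) ⊆
      tsupport (oscTest R p η ψ h ω μ τ θ) := tsupport_smul_subset_right _ _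
  refine ⟨contDiff_iff_contDiffAt.2 fun x => ?_,
    hu.2.1.of_isClosed_subset (isClosed_tsupport _) hsub, hsub.trans hu.2.2⟩
  by_cases hx : x ∈ tsupport ψ
  · exact hφ.contDiffAt_weighted hu.1.contDiffAt (ne_zero_of_mem_closedBall_smul hω hR
      (oscTest_apply_mem_closedBall hM hτ hτM h1 hx))
  · refine ContDiffAt.congr_of_eventuallyEq ?_ (weighted_eventuallyEq (oscTest_eventuallyEq_base hx))
    have e : weighted φ (fun y => (R * η y ^ p) • ω) = fun y => G (η y) • ω := by
      ext1 y
      have h2 := hη0 y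
      have h3 : 0 ≤ R * η y ^ p := by positivity
      rw [weighted, norm_smul, hω, mul_one, Real.norm_of_nonneg h3, hGφ _ h2, smul_smul]
    rw [e]
    exact ((hG.comp hη).smul contDiff_const).contDiffAt

end Oscillation

/-! ### The excess of the integrand, and its frozen version at a given value and direction. -/

section Density

variable {n m : ℕ}

/-- The value of `∂ₖ(φ(|u|)u)` when `∂ₖu = μ` and `u = z ≠ 0`. -/
noncomputable def dualFactor (φ : ℝ → ℝ) (μ z : CSpace m) : CSpace m :=
  φ ‖z‖ • (μ + (‖z‖ * deriv φ ‖z‖ / φ ‖z‖ * (herm μ (‖z‖⁻¹ • z)).re) • (‖z‖⁻¹ • z))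

/-- The value of `∂ₖ(√φ(|u|)u)` when `∂ₖu = μ` and `u = z ≠ 0`. -/
noncomputable def sqrtFactor (φ : ℝ → ℝ) (μ z : CSpace m) : CSpace m :=
  √(φ ‖z‖) • (μ + (‖z‖ * deriv φ ‖z‖ / φ ‖z‖ / 2 * (herm μ (‖z‖⁻¹ • z)).re) • (‖z‖⁻¹ • z))

/-- The excess of the dissipation integrand over `κ |∂ₖ(√φ(|u|)u)|²`. -/
noncomputable def excess (φ : ℝ → ℝ) (κ : ℝ) (B : Matrix (Fin m) (Fin m) ℂ)
    (u : RSpace n → CSpace m) (k : Fin n) (x : RSpace n) : ℝ :=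
  (herm (matVec B (partialDeriv k u x)) (partialDeriv k (weighted φ u) x)).re -
    κ * ‖partialDeriv k (sqrtWeighted φ u) x‖ ^ 2

/-- The excess at a point where `∂ₖu = μ` and `u = z ≠ 0`. -/
noncomputable def frozenExcess (φ : ℝ → ℝ) (κ : ℝ) (B : Matrix (Fin m) (Fin m) ℂ)
    (μ z : CSpace m) : ℝ :=
  (herm (matVec B μ) (dualFactor φ μ z)).re - κ * ‖sqrtFactor φ μ z‖ ^ 2

variable {φ : ℝ → ℝ} {κ : ℝ} {B : Matrix (Fin m) (Fin m) ℂ} {μ z : CSpace m}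

theorem dualFactor_smul (a : ℝ) : dualFactor φ (a • μ) z = a • dualFactor φ μ z := by
  simp only [dualFactor, herm_smul_left, Complex.re_ofReal_mul, smul_add, smul_smul]
  congr 2 <;> ring

theorem sqrtFactor_smul (a : ℝ) : sqrtFactor φ (a • μ) z = a • sqrtFactor φ μ z := by
  simp only [sqrtFactor, herm_smul_left, Complex.re_ofReal_mul, smul_add, smul_smul]
  congr 2 <;> ring

/-- For fixed `u(x)` the excess is a quadratic form in `∂ₖu`, so a real factor leaves as its square.
-/
theorem AdmissibleWeight.excess_eq (hφ : AdmissibleWeight φ) {u : RSpace n → CSpace m}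
    {x : RSpace n} (hu : DifferentiableAt ℝ u x) (h0 : u x ≠ 0) {k : Fin n} {a : ℝ}
    (ha : partialDeriv k u x = a • μ) :
    excess φ κ B u k x = a ^ 2 * frozenExcess φ κ B μ (u x) := by
  have h1 : partialDeriv k (weighted φ u) x = a • dualFactor φ μ (u x) := by
    rw [hφ.partialDeriv_weighted hu h0, ← dualFactor_smul, ← ha, dualFactor]
  have h2 : partialDeriv k (sqrtWeighted φ u) x = a • sqrtFactor φ μ (u x) := by
    rw [hφ.partialDeriv_sqrtWeighted hu h0, ← sqrtFactor_smul, ← ha, sqrtFactor]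
  rw [excess, frozenExcess, h1, h2, ha, matVec_smul, herm_smul_left, herm_smul_right,
    Complex.re_ofReal_mul, Complex.re_ofReal_mul, norm_smul, mul_pow, Real.norm_eq_abs, sq_abs]
  ring

theorem excess_congr {u v : RSpace n → CSpace m} {x : RSpace n} (h : u =ᶠ[𝓝 x] v) (k : Fin n) :
    excess φ κ B u k x = excess φ κ B v k x := by
  simp only [excess, partialDeriv, h.fderiv_eq, (weighted_eventuallyEq h).fderiv_eq,
    (sqrtWeighted_eventuallyEq h).fderiv_eq]

theorem continuousOn_unit : ContinuousOn (fun z : CSpace m => ‖z‖⁻¹ • z) {z | z ≠ 0} :=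
  (continuous_norm.continuousOn.inv₀ fun _ hz => norm_ne_zero_iff.2 hz).smul continuousOn_id

theorem continuousOn_herm_unit :
    ContinuousOn (fun z : CSpace m => (herm μ (‖z‖⁻¹ • z)).re) {z | z ≠ 0} :=
  Complex.continuous_re.comp_continuousOn (continuousOn_unit.inner (𝕜 := ℂ) continuousOn_const)

theorem mapsTo_norm_ne_zero : MapsTo (fun z : CSpace m => ‖z‖) {z | z ≠ 0} (Ioi 0) :=
  fun _ hz => norm_pos_iff.2 hz

theorem AdmissibleWeight.continuousOn_dualFactor (hφ : AdmissibleWeight φ) :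
    ContinuousOn (dualFactor φ μ) {z | z ≠ 0} :=
  (hφ.continuousOn.comp continuous_norm.continuousOn mapsTo_norm_ne_zero).smul
    (continuousOn_const.add (((hφ.continuousOn_ratio.comp continuous_norm.continuousOn
      mapsTo_norm_ne_zero).mul continuousOn_herm_unit).smul continuousOn_unit))

theorem AdmissibleWeight.continuousOn_sqrtFactor (hφ : AdmissibleWeight φ) :
    ContinuousOn (sqrtFactor φ μ) {z | z ≠ 0} :=
  (hφ.continuousOn.comp continuous_norm.continuousOn mapsTo_norm_ne_zero).sqrt.smul
    (continuousOn_const.add ((((hφ.continuousOn_ratio.comp continuous_norm.continuousOn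
      mapsTo_norm_ne_zero).div_const 2).mul continuousOn_herm_unit).smul continuousOn_unit))

theorem AdmissibleWeight.continuousAt_frozenExcess (hφ : AdmissibleWeight φ) (hz : z ≠ 0) :
    ContinuousAt (frozenExcess φ κ B μ) z := by
  have ho : {z : CSpace m | z ≠ 0} ∈ 𝓝 z := isOpen_ne.mem_nhds hz
  have h1 := (hφ.continuousOn_dualFactor (μ := μ)).continuousAt ho
  have h2 := (hφ.continuousOn_sqrtFactor (μ := μ)).continuousAt ho
  exact (Complex.continuous_re.continuousAt.comp (h1.inner (𝕜 := ℂ) continuousAt_const)).sub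
    (continuousAt_const.mul (h2.norm.pow 2))

theorem abs_frozenExcess_le (hκ : 0 ≤ κ) {C₁ C₂ : ℝ} (h1 : ‖dualFactor φ μ z‖ ≤ C₁)
    (h2 : ‖sqrtFactor φ μ z‖ ≤ C₂) :
    |frozenExcess φ κ B μ z| ≤ (∑ i, ∑ j, ‖B i j‖) * (‖μ‖ * C₁) + κ * C₂ ^ 2 := by
  have h3 : |(herm (matVec B μ) (dualFactor φ μ z)).re| ≤ (∑ i, ∑ j, ‖B i j‖) * (‖μ‖ * C₁) :=
    ((Complex.abs_re_le_norm _).trans (norm_herm_matVec_le B _ _)).trans (by gcongr)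
  have h4 : |κ * ‖sqrtFactor φ μ z‖ ^ 2| ≤ κ * C₂ ^ 2 := by
    rw [abs_of_nonneg (by positivity)]
    gcongr
  exact (abs_sub _ _).trans (add_le_add h3 h4)

variable {Ω : Set (RSpace n)} {𝒜 : Fin n → RSpace n → Matrix (Fin m) (Fin m) ℂ}

theorem AdmissibleWeight.integrableOn_excess (hφ : AdmissibleWeight φ)
    (hL : LamInf φ ^ 2 < 1) (hΩ : IsOpen Ω)
    (h𝒜 : ∀ h i j, LocallyIntegrableOn (fun x => 𝒜 h x i j) Ω volume)
    {u : RSpace n → CSpace m} (hu : IsC1c Ω u) (hw : IsC1c Ω (weighted φ u)) (k : Fin n) :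
    IntegrableOn (fun x => excess φ κ (𝒜 k x) u k x) Ω volume :=
  (hu.integrableOn_herm hΩ (h𝒜 k) hw k).re.sub
    ((hφ.integrableOn_norm_sqrtWeighted hL hΩ hu hw k).const_mul κ)

theorem AdmissibleWeight.setIntegral_excess_nonneg (hφ : AdmissibleWeight φ)
    (hL : LamInf φ ^ 2 < 1) (hΩ : IsOpen Ω)
    (h𝒜 : ∀ h i j, LocallyIntegrableOn (fun x => 𝒜 h x i j) Ω volume)
    {u : RSpace n → CSpace m} (hu : IsC1c Ω u) (hw : IsC1c Ω (weighted φ u))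
    (h : κ * (∫ x in Ω, ∑ h, ‖partialDeriv h (sqrtWeighted φ u) x‖ ^ 2) ≤
      (∫ x in Ω, ∑ h, herm (matVec (𝒜 h x) (partialDeriv h u x))
        (partialDeriv h (weighted φ u) x)).re) :
    0 ≤ ∫ x in Ω, ∑ k, excess φ κ (𝒜 k x) u k x := by
  have hint : IntegrableOn (fun x => ∑ h, herm (matVec (𝒜 h x) (partialDeriv h u x))
      (partialDeriv h (weighted φ u) x)) Ω volume :=
    integrable_finsetSum _ fun k _ => hu.integrableOn_herm hΩ (h𝒜 k) hw k
  have hint2 : IntegrableOn (fun x => κ * ∑ h, ‖partialDeriv h (sqrtWeighted φ u) x‖ ^ 2) Ω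
      volume :=
    (integrable_finsetSum _ fun k _ =>
      hφ.integrableOn_norm_sqrtWeighted hL hΩ hu hw k).const_mul κ
  have hre := integral_re hint
  have hsub := integral_sub hint.re hint2
  simp only [RCLike.re_to_complex] at hre hsub
  rw [← hre, ← integral_const_mul, ← sub_nonneg, ← hsub] at h
  refine h.trans_eq (integral_congr_ae (Eventually.of_forall fun x => ?_))
  simp only [excess, Complex.re_sum, Finset.mul_sum, Finset.sum_sub_distrib]

end Density

/-! ### The high-frequency limit of the excess, with a dominating function. -/

section Limit

variable {n m : ℕ} {φ : ℝ → ℝ} {κ : ℝ} {ω μ : CSpace m} {ψ η : RSpace n → ℝ} {h k : Fin n}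
  {R M : ℝ} {p : ℕ}

/-- The phase shift `-π/2` replaces `(cos, sin)` by `(sin, -cos)`, so the cross terms cancel and the
squares add to `1`. The limit is therefore pointwise, and no weak convergence of oscillations is
needed. -/
theorem oscSlope_sq_add_sq (τ : ℝ) (hτ : τ ≠ 0) (x : RSpace n) :
    oscSlope ψ h τ 0 k x ^ 2 + oscSlope ψ h τ (-(Real.pi / 2)) k x ^ 2 =
      (fderiv ℝ ψ x (EuclideanSpace.single k 1)) ^ 2 / τ ^ 4 +
        ψ x ^ 2 * (if h = k then 1 else 0) := by
  simp only [oscSlope, add_zero, ← sub_eq_add_neg, Real.cos_sub_pi_div_two, Real.sin_sub_pi_div_two]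
  have h1 := Real.sin_sq_add_cos_sq (τ ^ 2 * x h)
  set s := Real.sin (τ ^ 2 * x h)
  set c := Real.cos (τ ^ 2 * x h)
  set a := fderiv ℝ ψ x (EuclideanSpace.single k 1)
  have h2 : c ^ 2 = 1 - s ^ 2 := by linarith
  split_ifs
  · field_simp
    ring_nf
    simp only [h2]
    ring
  · field_simp
    ring_nf
    simp only [h2]
    ring

theorem tendsto_oscTest (h1 : ∀ᶠ x in 𝓝ˢ (tsupport ψ), η x = 1) (hM : ∀ x, |ψ x| ≤ M) (θ : ℝ)
    {x : RSpace n} (hx : x ∈ tsupport ψ) :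
    Tendsto (fun N : ℕ => oscTest R p η ψ h ω μ (N : ℝ) θ x) atTop (𝓝 (R • ω)) := by
  have h2 : Tendsto (fun N : ℕ => oscAmp ψ h (N : ℝ) θ x) atTop (𝓝 0) := by
    refine squeeze_zero_norm' ?_ (tendsto_const_div_atTop_nhds_zero_nat M)
    filter_upwards [eventually_gt_atTop 0] with N hN
    exact abs_oscAmp_le hM (by exact_mod_cast hN) x
  have h3 := (tendsto_const_nhds (x := R • ω)).add (h2.smul_const μ)
  rw [zero_smul, add_zero] at h3
  exact h3.congr fun N => ((oscTest_eventuallyEq_plateau h1 hx).eq_of_nhds).symm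

/-- The excess of two oscillating test functions in phase quadrature, divided by `τ²`. -/
noncomputable def oscExcess (φ : ℝ → ℝ) (κ : ℝ) (B : Fin n → Matrix (Fin m) (Fin m) ℂ)
    (R : ℝ) (p : ℕ) (η ψ : RSpace n → ℝ) (h : Fin n) (ω μ : CSpace m) (τ : ℝ)
    (x : RSpace n) : ℝ :=
  ((∑ k, excess φ κ (B k) (oscTest R p η ψ h ω μ τ 0) k x) +
    ∑ k, excess φ κ (B k) (oscTest R p η ψ h ω μ τ (-(Real.pi / 2))) k x) / τ ^ 2

variable {B : Fin n → Matrix (Fin m) (Fin m) ℂ} {τ θ : ℝ}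

theorem AdmissibleWeight.excess_oscTest (hφ : AdmissibleWeight φ) (hη : ContDiff ℝ 1 η)
    (hψ : ContDiff ℝ 1 ψ) (h1 : ∀ᶠ x in 𝓝ˢ (tsupport ψ), η x = 1) (hω : ‖ω‖ = 1) (hR : 0 < R)
    (hM : ∀ x, |ψ x| ≤ M) (hτ : 0 < τ) (hτM : M / τ * ‖μ‖ ≤ R / 2) {x : RSpace n}
    (hx : x ∈ tsupport ψ) (A : Matrix (Fin m) (Fin m) ℂ) :
    excess φ κ A (oscTest R p η ψ h ω μ τ θ) k x / τ ^ 2 =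
      oscSlope ψ h τ θ k x ^ 2 * frozenExcess φ κ A μ (oscTest R p η ψ h ω μ τ θ x) := by
  rw [hφ.excess_eq ((contDiff_oscTest hη hψ).differentiable one_ne_zero x)
    (ne_zero_of_mem_closedBall_smul hω hR (oscTest_apply_mem_closedBall hM hτ hτM h1 hx))
    (partialDeriv_oscTest hψ h1 hτ.ne' hx)]
  field_simp

theorem AdmissibleWeight.oscExcess_eq (hφ : AdmissibleWeight φ) (hη : ContDiff ℝ 1 η)
    (hψ : ContDiff ℝ 1 ψ) (h1 : ∀ᶠ x in 𝓝ˢ (tsupport ψ), η x = 1) (hω : ‖ω‖ = 1) (hR : 0 < R)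
    (hM : ∀ x, |ψ x| ≤ M) (hτ : 0 < τ) (hτM : M / τ * ‖μ‖ ≤ R / 2) {x : RSpace n}
    (hx : x ∈ tsupport ψ) :
    oscExcess φ κ B R p η ψ h ω μ τ x =
      ∑ k, (oscSlope ψ h τ 0 k x ^ 2 *
          frozenExcess φ κ (B k) μ (oscTest R p η ψ h ω μ τ 0 x) +
        oscSlope ψ h τ (-(Real.pi / 2)) k x ^ 2 *
          frozenExcess φ κ (B k) μ (oscTest R p η ψ h ω μ τ (-(Real.pi / 2)) x)) := by
  rw [oscExcess, ← Finset.sum_add_distrib, Finset.sum_div]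
  refine Finset.sum_congr rfl fun k _ => ?_
  rw [add_div, hφ.excess_oscTest hη hψ h1 hω hR hM hτ hτM hx,
    hφ.excess_oscTest hη hψ h1 hω hR hM hτ hτM hx]

/-- Off the support of `ψ` only the plateau is seen, so the two excess sums agree and do not depend
on `τ` or `μ`. The normalisation `μ = 0`, `τ = 1`, `θ = 0` names this common function; with `μ = 0`
the smallness condition on the amplitude is automatic. -/
theorem oscExcess_eq_of_notMem {x : RSpace n} (hx : x ∉ tsupport ψ) :
    oscExcess φ κ B R p η ψ h ω μ τ x =
      2 * (∑ k, excess φ κ (B k) (oscTest R p η ψ h ω 0 1 0) k x) / τ ^ 2 := by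
  have e : ∀ θ, ∀ k, excess φ κ (B k) (oscTest R p η ψ h ω μ τ θ) k x =
      excess φ κ (B k) (oscTest R p η ψ h ω 0 1 0) k x := fun θ k =>
    excess_congr ((oscTest_eventuallyEq_base hx).trans (oscTest_eventuallyEq_base hx).symm) k
  simp only [oscExcess, e]
  ring

theorem eventually_amp_small (hR : 0 < R) (M : ℝ) (μ : CSpace m) :
    ∀ᶠ N : ℕ in atTop, M / (N : ℝ) * ‖μ‖ ≤ R / 2 := by
  have h1 := (tendsto_const_div_atTop_nhds_zero_nat M).mul_const ‖μ‖
  rw [zero_mul] at h1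
  exact h1.eventually_le_const (by positivity)

/-- On the support of `ψ` the values tend to `Rω`, and of the squared slopes only the one in the
direction `h` survives. Off it a fixed quantity is divided by `τ²`. -/
theorem AdmissibleWeight.tendsto_oscExcess (hφ : AdmissibleWeight φ) (hη : ContDiff ℝ 1 η)
    (hψ : ContDiff ℝ 1 ψ) (h1 : ∀ᶠ x in 𝓝ˢ (tsupport ψ), η x = 1) (hω : ‖ω‖ = 1) (hR : 0 < R)
    (hM : ∀ x, |ψ x| ≤ M) (hM' : ∀ x, ∀ k, |fderiv ℝ ψ x (EuclideanSpace.single k 1)| ≤ M)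
    (x : RSpace n) :
    Tendsto (fun N : ℕ => oscExcess φ κ B R p η ψ h ω μ (N : ℝ) x) atTop
      (𝓝 (ψ x ^ 2 * frozenExcess φ κ (B h) μ (R • ω))) := by
  by_cases hx : x ∈ tsupport ψ
  · have hz : R • ω ≠ 0 := ne_zero_of_mem_closedBall_smul hω hR
      (Metric.mem_closedBall_self (by positivity))
    have hlim : ψ x ^ 2 * frozenExcess φ κ (B h) μ (R • ω) =
        ∑ k, (0 + 0 + (0 + ψ x ^ 2 * (if h = k then 1 else 0)) *
          frozenExcess φ κ (B k) μ (R • ω)) := by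
      simp
    rw [hlim]
    -- Replacing the frozen excess by its value at `Rω` costs a bounded squared slope times a
    -- quantity tending to `0`.
    have hterm : ∀ k, ∀ θ, Tendsto (fun N : ℕ => oscSlope ψ h (N : ℝ) θ k x ^ 2 *
        (frozenExcess φ κ (B k) μ (oscTest R p η ψ h ω μ (N : ℝ) θ x) -
          frozenExcess φ κ (B k) μ (R • ω))) atTop (𝓝 0) := by
      intro k θ
      have h2 := ((hφ.continuousAt_frozenExcess (κ := κ) (B := B k) (μ := μ) hz).tendsto.comp
        (tendsto_oscTest (p := p) (μ := μ) (h := h) h1 hM θ hx)).sub_const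
          (frozenExcess φ κ (B k) μ (R • ω))
      rw [sub_self] at h2
      refine bdd_le_mul_tendsto_zero' ((2 * M) ^ 2) ?_ h2
      filter_upwards [eventually_ge_atTop 1] with N hN
      rw [abs_of_nonneg (sq_nonneg _), ← sq_abs]
      have := abs_oscSlope_le (h := h) (k := k) (θ := θ) hM hM'
        (τ := N) (by exact_mod_cast hN) x
      gcongr
    have hsq : ∀ k, Tendsto (fun N : ℕ =>
        (fderiv ℝ ψ x (EuclideanSpace.single k 1)) ^ 2 / (N : ℝ) ^ 4 +
          ψ x ^ 2 * (if h = k then 1 else 0)) atTop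
        (𝓝 (0 + ψ x ^ 2 * (if h = k then 1 else 0))) := fun k =>
      (Tendsto.const_div_atTop ((tendsto_pow_atTop (by norm_num)).comp
        tendsto_natCast_atTop_atTop) _).add tendsto_const_nhds
    refine (tendsto_finsetSum _ fun k _ => ((hterm k 0).add (hterm k (-(Real.pi / 2)))).add
      ((hsq k).mul_const _)).congr' ?_
    filter_upwards [eventually_gt_atTop 0, eventually_amp_small hR M μ] with N hN hNM
    have hN' : (0 : ℝ) < N := by exact_mod_cast hN
    rw [hφ.oscExcess_eq hη hψ h1 hω hR hM hN' hNM hx]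
    refine Finset.sum_congr rfl fun k _ => ?_
    rw [← oscSlope_sq_add_sq (N : ℝ) hN'.ne']
    ring
  · simp only [oscExcess_eq_of_notMem hx, image_eq_zero_of_notMem_tsupport hx]
    rw [zero_pow two_ne_zero, zero_mul]
    exact Tendsto.const_div_atTop ((tendsto_pow_atTop (by norm_num)).comp
      tendsto_natCast_atTop_atTop) _

/-- The bound does not depend on `τ`: it combines the entries of the matrices on the support of `ψ`
with the excess of the bare plateau. -/
theorem AdmissibleWeight.abs_oscExcess_le (hφ : AdmissibleWeight φ) (hη : ContDiff ℝ 1 η)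
    (hψ : ContDiff ℝ 1 ψ) (h1 : ∀ᶠ x in 𝓝ˢ (tsupport ψ), η x = 1) (hω : ‖ω‖ = 1) (hR : 0 < R)
    (hM : ∀ x, |ψ x| ≤ M) (hM' : ∀ x, ∀ k, |fderiv ℝ ψ x (EuclideanSpace.single k 1)| ≤ M)
    (hκ : 0 ≤ κ) {C₁ C₂ : ℝ}
    (hC₁ : ∀ z ∈ Metric.closedBall (R • ω) (R / 2), ‖dualFactor φ μ z‖ ≤ C₁)
    (hC₂ : ∀ z ∈ Metric.closedBall (R • ω) (R / 2), ‖sqrtFactor φ μ z‖ ≤ C₂)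
    (hτ : 1 ≤ τ) (hτM : M / τ * ‖μ‖ ≤ R / 2) (x : RSpace n) :
    |oscExcess φ κ B R p η ψ h ω μ τ x| ≤
      (tsupport ψ).indicator (fun _ => ∑ k, 2 * (2 * M) ^ 2 *
        ((∑ i, ∑ j, ‖B k i j‖) * (‖μ‖ * C₁) + κ * C₂ ^ 2)) x +
      2 * ∑ k, |excess φ κ (B k) (oscTest R p η ψ h ω 0 1 0) k x| := by
  have hτ0 : 0 < τ := one_pos.trans_le hτ
  by_cases hx : x ∈ tsupport ψ
  · rw [indicator_of_mem hx, hφ.oscExcess_eq hη hψ h1 hω hR hM hτ0 hτM hx]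
    refine le_add_of_le_of_nonneg ((Finset.abs_sum_le_sum_abs _ _).trans
      (Finset.sum_le_sum fun k _ => ?_)) (by positivity)
    have key : ∀ θ, |oscSlope ψ h τ θ k x ^ 2 *
        frozenExcess φ κ (B k) μ (oscTest R p η ψ h ω μ τ θ x)| ≤ (2 * M) ^ 2 *
          ((∑ i, ∑ j, ‖B k i j‖) * (‖μ‖ * C₁) + κ * C₂ ^ 2) := by
      intro θ
      have hz := oscTest_apply_mem_closedBall (h := h) (p := p) (R := R) (ω := ω) (θ := θ)
        hM hτ0 hτM h1 hx
      rw [abs_mul, abs_of_nonneg (sq_nonneg _), ← sq_abs]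
      have h2 := abs_oscSlope_le (h := h) (k := k) (θ := θ) hM hM' hτ x
      have h3 := abs_frozenExcess_le (B := B k) hκ (hC₁ _ hz) (hC₂ _ hz)
      gcongr
    have h4 := abs_add_le (oscSlope ψ h τ 0 k x ^ 2 *
        frozenExcess φ κ (B k) μ (oscTest R p η ψ h ω μ τ 0 x))
      (oscSlope ψ h τ (-(Real.pi / 2)) k x ^ 2 *
        frozenExcess φ κ (B k) μ (oscTest R p η ψ h ω μ τ (-(Real.pi / 2)) x))
    linarith [key 0, key (-(Real.pi / 2))]
  · rw [indicator_of_notMem hx, zero_add, oscExcess_eq_of_notMem hx, abs_div, abs_mul,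
      abs_of_pos (two_pos : (0 : ℝ) < 2), abs_of_pos (by positivity : 0 < τ ^ 2)]
    refine (div_le_self (by positivity) (one_le_pow₀ hτ)).trans ?_
    gcongr
    exact Finset.abs_sum_le_sum_abs _ _

end Limit

/-! ### Necessity: the frozen inequality, the choice of `R` and `μ`, and passage to `Λ_∞`. -/

section Necessity

variable {n m : ℕ} {φ : ℝ → ℝ} {κ : ℝ} {ω μ : CSpace m} {Ω : Set (RSpace n)}
  {𝒜 : Fin n → RSpace n → Matrix (Fin m) (Fin m) ℂ} {R : ℝ}

theorem exists_bound_of_contDiff {ψ : RSpace n → ℝ} (hψ : ContDiff ℝ 1 ψ)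
    (hc : HasCompactSupport ψ) :
    ∃ M, (∀ x, |ψ x| ≤ M) ∧ ∀ x, ∀ k, |fderiv ℝ ψ x (EuclideanSpace.single k 1)| ≤ M := by
  obtain ⟨M₁, h1⟩ := hψ.continuous.bounded_above_of_compact_support hc
  obtain ⟨M₂, h2⟩ := (hψ.continuous_fderiv one_ne_zero).bounded_above_of_compact_support
    (hc.fderiv ℝ)
  refine ⟨max M₁ M₂, fun x => (h1 x).trans (le_max_left _ _), fun x k => ?_⟩
  refine (((fderiv ℝ ψ x).le_opNorm _).trans ?_).trans ((h2 x).trans (le_max_right _ _))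
  simp

/-- Dissipativity is applied to both phases, the sum is divided by `N²`, and dominated convergence
lets `N → ∞`. The cutoff `η` equals `1` near the support of `ψ`, so the plateau contributes no
gradient there. -/
theorem AdmissibleWeight.setIntegral_frozenExcess_nonneg (hφ : AdmissibleWeight φ)
    (hL : LamInf φ ^ 2 < 1) (hΩ : IsOpen Ω)
    (h𝒜 : ∀ h i j, LocallyIntegrableOn (fun x => 𝒜 h x i j) Ω volume) (hκ : 0 ≤ κ)
    (hdiss : ∀ u : RSpace n → CSpace m, IsC1c Ω u → IsC1c Ω (weighted φ u) →
      κ * (∫ x in Ω, ∑ h, ‖partialDeriv h (sqrtWeighted φ u) x‖ ^ 2) ≤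
        (∫ x in Ω, ∑ h, herm (matVec (𝒜 h x) (partialDeriv h u x))
          (partialDeriv h (weighted φ u) x)).re)
    (h : Fin n) (hω : ‖ω‖ = 1) (μ : CSpace m) (hR : 0 < R) {ψ : RSpace n → ℝ}
    (hψ : ContDiff ℝ 1 ψ) (hψc : HasCompactSupport ψ) (hψΩ : tsupport ψ ⊆ Ω) :
    0 ≤ ∫ x in Ω, ψ x ^ 2 * frozenExcess φ κ (𝒜 h x) μ (R • ω) := by
  obtain ⟨M, hM, hM'⟩ := exists_bound_of_contDiff hψ hψc
  obtain ⟨η, hη, hηc, hηΩ, hη01, h1⟩ := exists_cutoff hψc hΩ hψΩ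
  obtain ⟨p, hp, G, hG, hGφ⟩ := hφ.exists_contDiff_profile hR
  have hball : Metric.closedBall (R • ω) (R / 2) ⊆ {z | z ≠ 0} := fun z hz =>
    ne_zero_of_mem_closedBall_smul hω hR hz
  obtain ⟨C₁, hC₁⟩ := (isCompact_closedBall (R • ω) (R / 2)).exists_bound_of_continuousOn
    ((hφ.continuousOn_dualFactor (μ := μ)).mono hball)
  obtain ⟨C₂, hC₂⟩ := (isCompact_closedBall (R • ω) (R / 2)).exists_bound_of_continuousOn
    ((hφ.continuousOn_sqrtFactor (μ := μ)).mono hball)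
  have hu : ∀ μ' : CSpace m, ∀ τ θ, IsC1c Ω (oscTest R p η ψ h ω μ' τ θ) := fun μ' τ θ =>
    isC1c_oscTest hη hψ hηc hηΩ hp h1
  have hw : ∀ μ' : CSpace m, ∀ τ θ, 0 < τ → M / τ * ‖μ'‖ ≤ R / 2 →
      IsC1c Ω (weighted φ (oscTest R p η ψ h ω μ' τ θ)) := fun μ' τ θ hτ hτM =>
    hφ.isC1c_weighted_oscTest hG hGφ hη hψ hηc hηΩ (fun x => (hη01 x).1) hp h1 hω hR hM hτ hτM
  have hint : ∀ μ' : CSpace m, ∀ τ θ, 0 < τ → M / τ * ‖μ'‖ ≤ R / 2 → ∀ k,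
      IntegrableOn (fun x => excess φ κ (𝒜 k x) (oscTest R p η ψ h ω μ' τ θ) k x) Ω volume :=
    fun μ' τ θ hτ hτM k => hφ.integrableOn_excess hL hΩ h𝒜 (hu μ' τ θ) (hw μ' τ θ hτ hτM) k
  have hsum : ∀ τ θ, 0 < τ → M / τ * ‖μ‖ ≤ R / 2 →
      IntegrableOn (fun x => ∑ k, excess φ κ (𝒜 k x) (oscTest R p η ψ h ω μ τ θ) k x) Ω volume :=
    fun τ θ hτ hτM => integrable_finsetSum _ fun k _ => hint μ τ θ hτ hτM k
  have hlim : Tendsto (fun N : ℕ => ∫ x in Ω,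
      oscExcess φ κ (fun k => 𝒜 k x) R p η ψ h ω μ (N : ℝ) x) atTop
      (𝓝 (∫ x in Ω, ψ x ^ 2 * frozenExcess φ κ (𝒜 h x) μ (R • ω))) := by
    refine tendsto_integral_filter_of_dominated_convergence
      (fun x => (tsupport ψ).indicator (fun x => ∑ k, 2 * (2 * M) ^ 2 *
        ((∑ i, ∑ j, ‖𝒜 k x i j‖) * (‖μ‖ * C₁) + κ * C₂ ^ 2)) x +
        2 * ∑ k, |excess φ κ (𝒜 k x) (oscTest R p η ψ h ω 0 1 0) k x|) ?_ ?_ ?_ ?_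
    · filter_upwards [eventually_gt_atTop 0, eventually_amp_small hR M μ] with N hN hNM
      have hN' : (0 : ℝ) < N := by exact_mod_cast hN
      exact (((hsum N 0 hN' hNM).add (hsum N _ hN' hNM)).div_const _).aestronglyMeasurable
    · filter_upwards [eventually_ge_atTop 1, eventually_amp_small hR M μ] with N hN hNM
      refine Eventually.of_forall fun x => ?_
      have := hφ.abs_oscExcess_le (B := fun k => 𝒜 k x) (p := p) (h := h) hη hψ h1 hω hR hM hM' hκ
        hC₁ hC₂ (τ := N) (by exact_mod_cast hN) hNM x
      rw [Real.norm_eq_abs]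
      refine this.trans_eq ?_
      congr 1
    · refine Integrable.add ?_ ((integrable_finsetSum _ fun k _ =>
        (hint 0 1 0 one_pos (by simpa using by positivity) k).abs).const_mul 2)
      rw [integrable_indicator_iff (isClosed_tsupport ψ).measurableSet]
      refine IntegrableOn.mono_measure ?_ Measure.restrict_le_self
      refine integrable_finsetSum _ fun k _ => Integrable.const_mul (Integrable.add
        (Integrable.mul_const (integrable_finsetSum _ fun i _ => integrable_finsetSum _ fun j _ =>
          ?_) _) ?_) _
      · exact ((h𝒜 k i j).integrableOn_compact_subset hψΩ hψc).norm
      · exact integrableOn_const hψc.measure_lt_top.ne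
    · exact Eventually.of_forall fun x =>
        hφ.tendsto_oscExcess (B := fun k => 𝒜 k x) hη hψ h1 hω hR hM hM' x
  refine ge_of_tendsto hlim ?_
  filter_upwards [eventually_gt_atTop 0, eventually_amp_small hR M μ] with N hN hNM
  have hN' : (0 : ℝ) < N := by exact_mod_cast hN
  simp only [oscExcess]
  rw [integral_div, integral_add (hsum N 0 hN' hNM) (hsum N _ hN' hNM)]
  have key : ∀ θ, 0 ≤ ∫ x in Ω, ∑ k, excess φ κ (𝒜 k x) (oscTest R p η ψ h ω μ N θ) k x :=
    fun θ => hφ.setIntegral_excess_nonneg hL hΩ h𝒜 (hu μ N θ) (hw μ N θ hN' hNM)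
      (hdiss _ (hu μ N θ) (hw μ N θ hN' hNM))
  exact div_nonneg (add_nonneg (key _) (key _)) (by positivity)

theorem locallyIntegrableOn_frozenExcess {A : RSpace n → Matrix (Fin m) (Fin m) ℂ}
    (hA : ∀ i j, LocallyIntegrableOn (fun x => A x i j) Ω volume) (μ z : CSpace m) :
    LocallyIntegrableOn (fun x => frozenExcess φ κ (A x) μ z) Ω volume := by
  intro x hx
  have hc : ∀ i j, ∃ s ∈ 𝓝[Ω] x, IntegrableOn (fun y => A y i j) s volume := fun i j => hA i j x hx
  choose s hs hsi using hc
  -- A neighbourhood on which `1` is integrable takes care of the summand that does not depend on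
  -- the matrix.
  obtain ⟨t, ht, hti⟩ := (continuous_const (y := (1 : ℝ))).locallyIntegrable (μ := volume) x
  have hsx : (⋂ i, ⋂ j, s i j) ∩ t ∈ 𝓝[Ω] x :=
    inter_mem (iInter_mem.2 fun i => iInter_mem.2 fun j => hs i j) (mem_nhdsWithin_of_mem_nhds ht)
  refine ⟨_, hsx, ?_⟩
  have h1 : IntegrableOn (fun y => herm (matVec (A y) μ) (dualFactor φ μ z))
      ((⋂ i, ⋂ j, s i j) ∩ t) volume := by
    simp only [herm_matVec]
    refine integrable_finsetSum _ fun i _ => integrable_finsetSum _ fun j _ =>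
      Integrable.mul_const ?_ _
    exact (hsi i j).mono_set (inter_subset_left.trans
      ((iInter_subset _ i).trans (iInter_subset _ j)))
  have h2 : IntegrableOn (fun _ => κ * ‖sqrtFactor φ μ z‖ ^ 2) ((⋂ i, ⋂ j, s i j) ∩ t)
      (volume : Measure (RSpace n)) := by
    have := (hti.mono_set (inter_subset_right (s := ⋂ i, ⋂ j, s i j))).const_mul
      (κ * ‖sqrtFactor φ μ z‖ ^ 2)
    simp only [mul_one] at this
    exact this
  exact h1.re.sub h2

/-- The frozen excess in terms of the algebraic form. -/
theorem AdmissibleWeight.algForm_ge_of_frozenExcess_nonneg (hφ : AdmissibleWeight φ)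
    {t : ℝ} (ht : 0 < t) (hω : ‖ω‖ = 1) (B : Matrix (Fin m) (Fin m) ℂ) (lam : CSpace m)
    (h : 0 ≤ frozenExcess φ κ B (lam + (Lam φ t * (herm lam ω).re) • ω)
      (sqrtInv φ t • ω)) :
    κ * ‖lam‖ ^ 2 ≤ algForm (Lam φ t) B lam ω := by
  have hR := hφ.sqrtInv_pos ht
  have hΛ := hφ.lam_sqrt_ratio hR
  rw [hφ.sqrtInv_eq ht] at hΛ
  set R := sqrtInv φ t
  have hp := hφ.pos R hR
  have hq := hφ.neg_one_lt hR
  have hn : ‖R • ω‖ = R := by rw [norm_smul, hω, mul_one, Real.norm_of_nonneg hR.le]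
  have hunit : R⁻¹ • R • ω = ω := by rw [smul_smul, inv_mul_cancel₀ hR.ne', one_smul]
  set μ := lam + (Lam φ t * (herm lam ω).re) • ω with hμ
  set q := R * deriv φ R / φ R
  have hq2 : 2 + q ≠ 0 := by linarith
  -- The vector `μ` inverts the substitution `D ↦ D + (q/2) Re⟨D,ω⟩ ω`: since `1 + Λ = 2/(2+q)`, the
  -- two multiples of `ω` cancel.
  have hlam : μ + (q / 2 * (herm μ ω).re) • ω = lam := by
    rw [hμ, herm_add_smul_unit hω, add_assoc, ← add_smul, hΛ]
    have : -q / (2 + q) * (herm lam ω).re + q / 2 * ((1 + -q / (2 + q)) * (herm lam ω).re) = 0 := by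
      field_simp
      ring
    rw [this, zero_smul, add_zero]
  have hform := algForm_substitution hq2 B hω μ
  rw [hlam, ← hΛ] at hform
  rw [frozenExcess, dualFactor, sqrtFactor, hn, hunit, hlam, herm_smul_right,
    Complex.re_ofReal_mul, ← hform, norm_smul, mul_pow, Real.norm_eq_abs, sq_abs,
    Real.sq_sqrt hp.le] at h
  have h2 : 0 ≤ φ R * (algForm (Lam φ t) B lam ω - κ * ‖lam‖ ^ 2) := by linarith
  linarith [nonneg_of_mul_nonneg_right h2 hp]

theorem continuous_matVec (B : Matrix (Fin m) (Fin m) ℂ) : Continuous (matVec B) :=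
  (PiLp.continuous_toLp 2 _).comp
    ((Continuous.matrix_mulVec continuous_const continuous_id).comp (PiLp.continuous_ofLp 2 _))

theorem continuous_algForm (L : ℝ) (B : Matrix (Fin m) (Fin m) ℂ) {X : Type*}
    [TopologicalSpace X] {f g : X → CSpace m} (hf : Continuous f) (hg : Continuous g) :
    Continuous fun x => algForm L B (f x) (g x) := by
  have h1 : Continuous fun x => matVec B (f x) := (continuous_matVec B).comp hf
  have h2 : Continuous fun x => matVec B (g x) := (continuous_matVec B).comp hg
  simp only [algForm, herm]
  fun_prop

theorem AdmissibleWeight.ae_algForm_lam_ge (hφ : AdmissibleWeight φ) (hL : LamInf φ ^ 2 < 1)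
    (hΩ : IsOpen Ω) (h𝒜 : ∀ h i j, LocallyIntegrableOn (fun x => 𝒜 h x i j) Ω volume)
    (hκ : 0 ≤ κ)
    (hdiss : ∀ u : RSpace n → CSpace m, IsC1c Ω u → IsC1c Ω (weighted φ u) →
      κ * (∫ x in Ω, ∑ h, ‖partialDeriv h (sqrtWeighted φ u) x‖ ^ 2) ≤
        (∫ x in Ω, ∑ h, herm (matVec (𝒜 h x) (partialDeriv h u x))
          (partialDeriv h (weighted φ u) x)).re)
    (h : Fin n) {t : ℝ} (ht : 0 < t) (hω : ‖ω‖ = 1) (lam : CSpace m) :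
    ∀ᵐ x ∂(volume.restrict Ω), κ * ‖lam‖ ^ 2 ≤ algForm (Lam φ t) (𝒜 h x) lam ω := by
  have hloc := locallyIntegrableOn_frozenExcess (κ := κ) (φ := φ) (h𝒜 h)
    (lam + (Lam φ t * (herm lam ω).re) • ω) (sqrtInv φ t • ω)
  have hnonneg := ae_nonneg_of_forall_cutoff hΩ hloc fun ψ hψ hψc hψΩ =>
    hφ.setIntegral_frozenExcess_nonneg hL hΩ h𝒜 hκ hdiss h hω _ (hφ.sqrtInv_pos ht) hψ hψc hψΩ
  filter_upwards [hnonneg] with x hx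
  exact hφ.algForm_ge_of_frozenExcess_nonneg ht hω _ _ hx

theorem tendsto_algForm_lam (hφ : AdmissibleWeight φ) (B : Matrix (Fin m) (Fin m) ℂ)
    (lam ω : CSpace m) :
    Tendsto (fun N : ℕ => algForm (Lam φ ((N : ℝ) + 1)) B lam ω) atTop
      (𝓝 (algForm (LamInf φ) B lam ω)) := by
  have htend : Tendsto (fun N : ℕ => Lam φ ((N : ℝ) + 1)) atTop (𝓝 (LamInf φ)) :=
    hφ.tendsto_lam.comp (tendsto_atTop_add_const_right _ _ tendsto_natCast_atTop_atTop)
  have hcont : Continuous fun L : ℝ => algForm L B lam ω := by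
    simp only [algForm]
    fun_prop
  exact (hcont.tendsto _).comp htend

theorem isClosed_algForm_ge (κ L : ℝ) (B : Matrix (Fin m) (Fin m) ℂ) :
    IsClosed {z : CSpace m × Metric.sphere (0 : CSpace m) 1 |
      κ * ‖z.1‖ ^ 2 ≤ algForm L B z.1 (z.2 : CSpace m)} :=
  isClosed_le (by fun_prop)
    (continuous_algForm L B continuous_fst (continuous_subtype_val.comp continuous_snd))

theorem algForm_ge_of_dense {L : ℝ} {B : Matrix (Fin m) (Fin m) ℂ}
    {S : Set (CSpace m × Metric.sphere (0 : CSpace m) 1)} (hS : Dense S)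
    (h : ∀ z ∈ S, κ * ‖z.1‖ ^ 2 ≤ algForm L B z.1 (z.2 : CSpace m))
    (z : CSpace m × Metric.sphere (0 : CSpace m) 1) :
    κ * ‖z.1‖ ^ 2 ≤ algForm L B z.1 (z.2 : CSpace m) :=
  closure_minimal h (isClosed_algForm_ge κ L B) (hS z)

/-- The exceptional null set depends on `t`, `λ` and `ω`. Countably many choices, `t = N + 1` and a
dense set of pairs `(λ, ω)`, give one null set; outside it the limit `N → ∞` and continuity of the
form in `(λ, ω)` give the rest. -/
theorem algForm_ge_of_strictDissipative (hφ : AdmissibleWeight φ) (hL : LamInf φ ^ 2 < 1)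
    (hΩ : IsOpen Ω) (h𝒜 : ∀ h i j, LocallyIntegrableOn (fun x => 𝒜 h x i j) Ω volume)
    (hκ : 0 ≤ κ)
    (hdiss : ∀ u : RSpace n → CSpace m, IsC1c Ω u → IsC1c Ω (weighted φ u) →
      κ * (∫ x in Ω, ∑ h, ‖partialDeriv h (sqrtWeighted φ u) x‖ ^ 2) ≤
        (∫ x in Ω, ∑ h, herm (matVec (𝒜 h x) (partialDeriv h u x))
          (partialDeriv h (weighted φ u) x)).re) :
    ∀ᵐ x ∂(volume.restrict Ω), ∀ (h : Fin n) (lam ω : CSpace m),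
      ‖ω‖ = 1 → κ * ‖lam‖ ^ 2 ≤ algForm (LamInf φ) (𝒜 h x) lam ω := by
  obtain ⟨S, hSc, hSd⟩ :=
    TopologicalSpace.exists_countable_dense (CSpace m × Metric.sphere (0 : CSpace m) 1)
  have hae : ∀ h : Fin n, ∀ N : ℕ, ∀ z ∈ S, ∀ᵐ x ∂(volume.restrict Ω),
      κ * ‖z.1‖ ^ 2 ≤ algForm (Lam φ ((N : ℝ) + 1)) (𝒜 h x) z.1 (z.2 : CSpace m) :=
    fun h N z _ => hφ.ae_algForm_lam_ge hL hΩ h𝒜 hκ hdiss h (by positivity)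
      (mem_sphere_zero_iff_norm.1 z.2.2) z.1
  have hae' : ∀ᵐ x ∂(volume.restrict Ω), ∀ h : Fin n, ∀ N : ℕ, ∀ z ∈ S,
      κ * ‖z.1‖ ^ 2 ≤ algForm (Lam φ ((N : ℝ) + 1)) (𝒜 h x) z.1 (z.2 : CSpace m) :=
    ae_all_iff.2 fun h => ae_all_iff.2 fun N => (ae_ball_iff hSc).2 (hae h N)
  refine hae'.mono fun x hx h lam ω hω => ?_
  exact algForm_ge_of_dense hSd (fun z hz => ge_of_tendsto' (tendsto_algForm_lam hφ _ _ _)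
    fun N => hx h N z hz) (lam, ⟨ω, mem_sphere_zero_iff_norm.2 hω⟩)

end Necessity

theorem mainTheorem2 (n m : ℕ) (φ : ℝ → ℝ) (hφ : AdmissibleWeight φ)
    (hΛ : sSup ((fun t => Lam φ t ^ 2) '' Ioi 0) < 1)
    (Ω : Set (RSpace n)) (hΩ : IsOpen Ω) (hΩc : IsConnected Ω)
    (𝒜 : Fin n → RSpace n → Matrix (Fin m) (Fin m) ℂ)
    (h𝒜 : ∀ h i j, LocallyIntegrableOn (fun x => 𝒜 h x i j) Ω volume) :
    StrictDissipative φ Ω 𝒜 ↔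
      ∃ κ' : ℝ, 0 < κ' ∧ ∀ᵐ x ∂(volume.restrict Ω), ∀ (h : Fin n) (lam ω : CSpace m),
        ‖ω‖ = 1 → κ' * ‖lam‖ ^ 2 ≤ algForm (LamInf φ) (𝒜 h x) lam ω := by
  have hL := hφ.lamInf_sq_lt_one hΛ
  constructor
  · rintro ⟨κ, hκ, hdiss⟩
    exact ⟨κ, hκ, algForm_ge_of_strictDissipative hφ hL hΩ h𝒜 hκ.le hdiss⟩
  · rintro ⟨κ, hκ, hB⟩
    exact strictDissipative_of_algForm_ge hφ hL hΩ h𝒜 hκ hB
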